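/- **Setting.** Let $\mathcal X\subset\mathbb R^d$ be compact, $\rho_x$ a probability measure on $\mathcal X$, and $\mathcal H_K$ the reproducing kernel Hilbert space of a symmetric positive semidefinite kernel $K:\mathcal X\times\mathcal X\to\mathbb R$ with $\sup_x\sqrt{K(x,x)}\le\kappa<\infty$, such that $x\mapsto K_x=K(x,\cdot)\in\mathcal H_K$ is (strongly) measurable. Let $L_Kg=\int K_x\,g(x)\,d\rho_x(x)$, $L_K:L_2(\mathcal X,\rho_x)\to\mathcal H_K$, be the integral operator, which is also regarded as a positive operator on $L_2(\mathcal X,\rho_x)$; let $L_K^r$ be its spectral powers, with values in $\mathcal H_K$ for $r\ge\frac12$, and $\mathcal N(\lambda)=\operatorname{Tr}((L_K+\lambda I)^{-1}L_K)$. For $k=0$ (target) and $k=1,\dots,m$ (sources) let $\rho^{(k)}=\rho^{(k)}_{y|x}\,\rho_x$ be a probability distribution on $\mathcal X\times\mathbb R$ whose regression function $f^{(k)}(x)=\int y\,d\rho^{(k)}_{y|x}$ belongs to $\mathcal H_K$. Put $\delta^{(k)}=f^{(0)}-f^{(k)}$ and $\mathcal A_h=\{1\le k\le m:\|\delta^{(k)}\|_K\le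 h\}$ for $h\ge0$, and for $0\le\ell\le m$ let $h_\ell$ be the smallest $h\ge0$ with $|\mathcal A_h|\ge\ell$. For sample sizes $n_0,\dots,n_m$ let $(x_i^{(k)},y_i^{(k)})_{i\le n_k}$ be i.i.d. from $\rho^{(k)}$, for each $k$. The target sample is split at random, independently of its values, into $\mathcal T_1$ and $\mathcal T_2$, where for some constant $c>0$ the probability that $|\mathcal T_1|\ge c\,n_0$ tends to $1$ as $\min_kn_k\to\infty$ (for instance, $\mathcal T_1$ is a uniformly chosen half of the sample). With $\mathcal S^{(0)}=\mathcal T_1$ and $\mathcal S^{(k)}$ the $k$-th source sample, let $$\widehat f^{(k)}=\arg\min_{f\in\mathcal H_K}\Big\{\frac1{|\mathcal S^{(k)}|}\sum_{(x,y)\in\mathcal S^{(k)}}(f(x)-y)^2+\lambda^{(k)}\|f\|_K^2\Big\},\qquad \widehat\delta^{(k)}=\widehat f^{(k)}-\widehat f^{(0)} .$$ Let $\widehat R_k=|\{1\le j\le m:\|\widehat\delta^{(j)}\|_K\le\|\widehat\delta^{(k)}\|_K\}|$ be the rank of $\|\widehat\delta^{(k)}\|_K$ among $\|\widehat\delta^{(1)}\|_K,\dots,\|\widehat\delta^{(m)}\|_K$,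 and $\widehat{\mathcal A}_\ell=\{1\le k\le m:\widehat R_k\le\ell\}$ for $0\le\ell\le m$. **Assumptions.** (1) There are $B,\gamma>0$ such that for every $k$: $E[(y^{(k)})^2]<\infty$ and, for ($\rho_x$-almost) every $x$, $$\int\Big(e^{|y-f^{(k)}(x)|/B}-\frac{|y-f^{(k)}(x)|}B-1\Big)\,d\rho^{(k)}_{y|x}(y)\le\frac{\gamma^2}{2B^2}.$$ (2) There are $\alpha\in(0,1]$ and $Q\ge1$ with $\mathcal N(\lambda)\le Q\lambda^{-\alpha}$ for all $\lambda>0$. (3) There is $r\in(\frac12,1]$ such that for every $k$, $f^{(k)}=L_K^rg^{(k)}$ in $\mathcal H_K$ for some $g^{(k)}\in L_2(\mathcal X,\rho_x)$. (4) $\lambda^{(k)}\asymp n_k^{-1/(2r+\alpha)}$ for $0\le k\le m$, i.e. $c_1n_k^{-1/(2r+\alpha)}\le\lambda^{(k)}\le c_2n_k^{-1/(2r+\alpha)}$ for some constants $c_1,c_2>0$. (5) $\|\delta^{(k)}\|_K>0$ for $1\le k\le m$, and $\|\delta^{(i)}\|_K\ne\|\delta^{(j)}\|_K$ for all $1\le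 i,j\le m$ with $i\ne j$. **Conclusion.** For every $0\le\ell\le m$, $h_\ell$ is the smallest $h\ge0$ with $|\mathcal A_h|=\ell$, and, as $\min_{0\le k\le m}n_k\to\infty$, $$P\big(\widehat{\mathcal A}_\ell=\mathcal A_{h_\ell}\big)\to1 .$$ -/

import Mathlib

open MeasureTheory ProbabilityTheory Filter Topology
open scoped ENNReal InnerProductSpace

noncomputable section

namespace TransferKRR

section Kernel

variable {X : Type*} (H : Type*) [NormedAddCommGroup H] [InnerProductSpace ℝ H]
  [CompleteSpace H] [RKHS ℝ H X ℝ]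

/-- The kernel section `K_x = K(x, ·)`, an element of the reproducing kernel Hilbert space `H`
of real functions on `X`; it satisfies `⟪f, K_x⟫ = f x` for all `f : H`. -/
def kernelSection (x : X) : H := RKHS.kerFun H x (1 : ℝ)

/-- The reproducing kernel `K : X × X → ℝ` of `H`. -/
def scalarKernel (x y : X) : ℝ := kernelSection H x y

variable {H} in
/-- The reproducing property. -/
theorem inner_kernelSection (f : H) (x : X) : ⟪f, kernelSection H x⟫_ℝ = f x := by
  simp [kernelSection]

/-- `⟪K_x, K_y⟫ = K(x, y)`. -/
theorem inner_kernelSection_kernelSection (x y : X) :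
    ⟪kernelSection H x, kernelSection H y⟫_ℝ = scalarKernel H x y :=
  inner_kernelSection _ _

variable [MeasurableSpace X]

/-- Standing assumptions on the kernel: `x ↦ K_x` is measurable (so that the Bochner integral
`∫ K_x f(x) dρ(x)` makes sense), and `√K(x, x) ≤ κ` for all `x`. -/
structure BoundedKernel (ρ : Measure X) (κ : ℝ) : Prop where
  aestronglyMeasurable : AEStronglyMeasurable (fun x : X => kernelSection H x) ρ
  bound : ∀ x : X, √(scalarKernel H x x) ≤ κ

variable {H} {ρ : Measure X} {κ : ℝ}

theorem BoundedKernel.norm_kernelSection_le (hK : BoundedKernel H ρ κ) (x : X) :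
    ‖kernelSection H x‖ ≤ κ := by
  have h := hK.bound x
  rwa [← inner_kernelSection_kernelSection, real_inner_self_eq_norm_sq, Real.sqrt_sq (norm_nonneg _)] at h

variable [IsProbabilityMeasure ρ]

theorem BoundedKernel.nonneg (hK : BoundedKernel H ρ κ) : 0 ≤ κ := by
  obtain ⟨x⟩ : Nonempty X := nonempty_of_isProbabilityMeasure ρ
  exact (norm_nonneg _).trans (hK.norm_kernelSection_le x)

theorem BoundedKernel.integrable_smul (hK : BoundedKernel H ρ κ) (g : Lp ℝ 2 ρ) :
    Integrable (fun x => g x • kernelSection H x) ρ :=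
  ((Lp.memLp g).integrable one_le_two).smul_bdd κ hK.aestronglyMeasurable
    (Eventually.of_forall hK.norm_kernelSection_le)

theorem BoundedKernel.memLp (hK : BoundedKernel H ρ κ) (f : H) :
    MemLp (fun x : X => f x) 2 ρ := by
  refine MemLp.of_bound ?_ (‖f‖ * κ) (Eventually.of_forall fun x => ?_)
  · simp_rw [← inner_kernelSection]
    exact aestronglyMeasurable_const.inner hK.aestronglyMeasurable
  · rw [← inner_kernelSection]
    exact (norm_inner_le_norm _ _).trans
      (mul_le_mul_of_nonneg_left (hK.norm_kernelSection_le x) (norm_nonneg _))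

/-- The integral operator `L_K : L²(X, ρ) → H_K`, `L_K g = ∫ K_x g(x) dρ(x)`. -/
def integralOp (hK : BoundedKernel H ρ κ) : Lp ℝ 2 ρ →L[ℝ] H :=
  LinearMap.mkContinuous
    { toFun := fun g => ∫ x, g x • kernelSection H x ∂ρ
      map_add' := fun g g' => by
        rw [← integral_add (hK.integrable_smul g) (hK.integrable_smul g')]
        refine integral_congr_ae ?_
        filter_upwards [Lp.coeFn_add g g'] with x hx
        rw [hx, Pi.add_apply, add_smul]
      map_smul' := fun c g => by
        rw [RingHom.id_apply, ← integral_smul]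
        refine integral_congr_ae ?_
        filter_upwards [Lp.coeFn_smul c g] with x hx
        rw [hx, Pi.smul_apply, smul_assoc] }
    κ (fun g => by
      have h1 : Integrable (fun x => ‖g x‖) ρ := ((Lp.memLp g).integrable one_le_two).norm
      have h2 : ∫ x, ‖g x‖ ∂ρ ≤ ‖g‖ := by
        rw [integral_norm_eq_lintegral_enorm (Lp.aestronglyMeasurable g),
          ← eLpNorm_one_eq_lintegral_enorm, Lp.norm_def]
        exact ENNReal.toReal_mono (Lp.eLpNorm_ne_top g)
          (eLpNorm_le_eLpNorm_of_exponent_le one_le_two (Lp.aestronglyMeasurable g))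
      calc ‖∫ x, g x • kernelSection H x ∂ρ‖ ≤ ∫ x, κ * ‖g x‖ ∂ρ := by
            refine norm_integral_le_of_norm_le (h1.const_mul κ) (Eventually.of_forall fun x => ?_)
            rw [norm_smul, mul_comm]
            exact mul_le_mul_of_nonneg_right (hK.norm_kernelSection_le x) (norm_nonneg _)
        _ = κ * ∫ x, ‖g x‖ ∂ρ := integral_const_mul _ _
        _ ≤ κ * ‖g‖ := mul_le_mul_of_nonneg_left h2 hK.nonneg)

/-- The canonical map `H_K → L²(X, ρ)` sending a function to its class. -/
def inclusion (hK : BoundedKernel H ρ κ) : H →L[ℝ] Lp ℝ 2 ρ :=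
  LinearMap.mkContinuous
    { toFun := fun f => (hK.memLp f).toLp _
      map_add' := fun f f' => by
        rw [← MemLp.toLp_add]
        exact MemLp.toLp_congr _ _ (Eventually.of_forall fun x => by simp)
      map_smul' := fun c f => by
        rw [RingHom.id_apply, ← MemLp.toLp_const_smul]
        exact MemLp.toLp_congr _ _ (Eventually.of_forall fun x => by simp) }
    κ (fun f => by
      refine (Lp.norm_le_of_ae_bound (C := κ * ‖f‖) (mul_nonneg hK.nonneg (norm_nonneg _)) ?_).trans
        (by simp [measureUnivNNReal])
      filter_upwards [(hK.memLp f).coeFn_toLp] with x hx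
      simp only [LinearMap.coe_mk, AddHom.coe_mk]
      rw [hx, ← inner_kernelSection, mul_comm]
      exact (norm_inner_le_norm _ _).trans
        (mul_le_mul_of_nonneg_left (hK.norm_kernelSection_le x) (norm_nonneg _)))

/-- `L_K` regarded as a (positive, self-adjoint) operator on `L²(X, ρ)`. -/
def integralOpL2 (hK : BoundedKernel H ρ κ) : Lp ℝ 2 ρ →L[ℝ] Lp ℝ 2 ρ :=
  inclusion hK ∘L integralOp hK

/-- The `r`-th power of the integral operator, as a map `L²(X, ρ) → H_K` (for `1/2 ≤ r ≤ 1`).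
Spectrally, `L_K^r g = ∑ₜ t ^ r • Pₜ g`, where `t` runs through the eigenvalues of `L_K` and `Pₜ` is
the orthogonal projection of `L²(X, ρ)` onto the eigenspace of `t`. The function in `H_K` that
represents an eigenvector `ψ` of an eigenvalue `t ≠ 0` is `t⁻¹ • L_K ψ`, so that the term
`t ^ r • Pₜ g` is represented in `H_K` by `t ^ (r - 1) • L_K (Pₜ g)`; the series of these terms
converges in `H_K` as soon as `r ≥ 1/2`. The sum may run through all real `t`: if `t` is not an
eigenvalue then `Pₜ = 0`, and for `t = 0` the term vanishes because `L_K P₀ = 0`. -/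
def integralOpPow (hK : BoundedKernel H ρ κ) (r : ℝ) (g : Lp ℝ 2 ρ) : H :=
  ∑' t : ℝ, t ^ (r - 1) • integralOp hK
    ((integralOpL2 hK - t • ContinuousLinearMap.id ℝ (Lp ℝ 2 ρ)).ker.starProjection g)

end Kernel

section Trace

variable {E : Type*} [NormedAddCommGroup E] [InnerProductSpace ℝ E] [CompleteSpace E]

/-- The trace `∑ e, ⟪e, A e⟫` of a positive operator `A` on a Hilbert space, the sum running over
an orthonormal (Hilbert) basis; its value in `[0, ∞]` does not depend on the basis. -/
def posTrace (A : E →L[ℝ] E) : ℝ≥0∞ :=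
  ∑' e : (exists_hilbertBasis ℝ E).choose, ENNReal.ofReal ⟪(e : E), A (e : E)⟫_ℝ

end Trace

section Estimation

variable {X : Type*} {H : Type*} [NormedAddCommGroup H] [InnerProductSpace ℝ H]
  [CompleteSpace H] [RKHS ℝ H X ℝ]

/-- The effective dimension `N(t) = Tr((L_K + t I)⁻¹ L_K)`. -/
def effectiveDim [MeasurableSpace X] {ρ : Measure X} [IsProbabilityMeasure ρ] {κ : ℝ}
    (hK : BoundedKernel H ρ κ) (t : ℝ) : ℝ≥0∞ :=
  posTrace (Ring.inverse (integralOpL2 hK + t • 1) * integralOpL2 hK)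

/-- The kernel ridge regression objective
`|s|⁻¹ ∑_{i ∈ s} (f(x_i) - y_i)² + lam ‖f‖²` on the data points `z i = (x_i, y_i)`, `i ∈ s`. -/
def krrObjective {ι : Type*} (s : Finset ι) (z : ι → X × ℝ) (lam : ℝ) (f : H) : ℝ :=
  (1 / (s.card : ℝ)) * ∑ i ∈ s, (f (z i).1 - (z i).2) ^ 2 + lam * ‖f‖ ^ 2

variable (H) in
/-- The kernel ridge regression estimator: the minimizer over `H_K` of the objective
(it exists and is unique for `lam > 0`). -/
def krr {ι : Type*} (s : Finset ι) (z : ι → X × ℝ) (lam : ℝ) : H :=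
  Classical.epsilon fun f : H => ∀ g : H, krrObjective s z lam f ≤ krrObjective s z lam g

variable {m : ℕ}

/-- The contrast `δ^(k) = f^(0) - f^(k)` of the `k`-th source; index `0` is the target and the
`m` sources are the indices `k.succ`, `k : Fin m`. -/
def contrast (f : Fin (m + 1) → H) (k : Fin m) : H := f 0 - f k.succ

open Classical in
/-- The `h`-transferable index set `A_h = {k : ‖δ^(k)‖ ≤ h}`. -/
def transferable (f : Fin (m + 1) → H) (h : ℝ) : Finset (Fin m) :=
  Finset.univ.filter fun k => ‖contrast f k‖ ≤ h

/-- `h_ℓ`, the smallest `h ≥ 0` with `|A_h| ≥ ℓ`. -/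
def level (f : Fin (m + 1) → H) (ℓ : ℕ) : ℝ :=
  sInf {h : ℝ | 0 ≤ h ∧ ℓ ≤ (transferable f h).card}

variable (H) in
/-- The estimated contrast of the `k`-th source: the KRR estimator on the `k`-th source data minus
the KRR estimator on the part of the target data with indices in `J`. -/
def estContrast {n : Fin (m + 1) → ℕ} (z : ∀ k, Fin (n k) → X × ℝ) (J : Finset (Fin (n 0)))
    (lam : Fin (m + 1) → ℝ) (k : Fin m) : H :=
  krr H Finset.univ (z k.succ) (lam k.succ) - krr H J (z 0) (lam 0)

open Classical in
/-- The rank of `v k` among `v 0, …, v (m - 1)`: the smallest value has rank `1`. -/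
def rank (v : Fin m → ℝ) (k : Fin m) : ℕ :=
  (Finset.univ.filter fun j => v j ≤ v k).card

variable (H) in
/-- The estimated index set of the `ℓ` best sources: those whose estimated contrast has a
norm of rank at most `ℓ`. -/
def estTransferable {n : Fin (m + 1) → ℕ} (z : ∀ k, Fin (n k) → X × ℝ) (J : Finset (Fin (n 0)))
    (lam : Fin (m + 1) → ℝ) (ℓ : ℕ) : Finset (Fin m) :=
  Finset.univ.filter fun k => rank (fun j => ‖estContrast H z J lam j‖) k ≤ ℓ

end Estimation

end TransferKRR

end

/-!
Kernel ridge regression is consistent in the norm of `H_K`, for the target and for every source. The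
norms of the true contrasts are distinct, so with probability tending to one the norms of the
estimated contrasts are in the same order, the ranks agree, and the selected sets agree.

Let `T` be the covariance operator on `H_K`, `A` the sample covariance of a sample of size `N`, and
`v_i = K_{x_i}`. The normal equations (`krr_sub_eq`) split the error of the estimator into
`(A + t)⁻¹ (N⁻¹ ∑ (y_i - f(x_i)) v_i)` and the bias `t (A + t)⁻¹ f`.

*Bias.* The source condition puts `f` in the closure of the range of `T`. If `f` is close to `T g`, the
bias is at most `‖f - T g‖ + t ‖g‖ + ‖A g - T g‖` (`norm_smul_regInv_le`), and the last term tends to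
zero in mean square by the law of large numbers. No rate is needed.

*Noise.* Averaging over the responses given the design bounds the mean square of the noise term by
the conditional variance times `(N t)⁻¹ tr ((A + t)⁻¹ A)`. Instead of a concentration inequality for
`A`, concavity of `A ↦ tr ((A + t)⁻¹ A)` is used: the tangent at `T` bounds the empirical trace, for each
sample, by the population trace and an empirical mean (`sampleMean_inner_regInv_le`). Both are of the
order `t ^ (-α)`: the mean is a Hilbert-Schmidt norm that is read off the effective dimension, and the
trace is recovered from such norms by telescoping over `t, 2t, 4t, …`
(`sum_inner_covOp_regInv_le`), which makes the spectral theorem for `T` unnecessary. For `t` of the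
order `n ^ (-1 / (2 r + α))` the noise term is then of the order `n ^ ((1 + α) / (2 r + α) - 1)` in mean
square, and this tends to zero because `2 r > 1`.

The part of the target sample that is used is random but independent of the data, and the bounds are
uniform over all subsamples that are large enough (`measure_random_index_le`).
-/

noncomputable section

namespace TransferKRR

/-! ### Regularized inverses of positive operators -/

section RegularizedInverse

variable {E : Type*} [NormedAddCommGroup E] [InnerProductSpace ℝ E] [CompleteSpace E]

/-- The regularized inverse `(A + t I)⁻¹` of an operator on a Hilbert space. It is a genuine inverse
when `A` is positive and `t > 0`. -/
def regInv (A : E →L[ℝ] E) (t : ℝ) : E →L[ℝ] E := Ring.inverse (A + t • 1)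

variable {A : E →L[ℝ] E} {t : ℝ}

theorem isUnit_add_smul_one (hA : A.IsPositive) (ht : 0 < t) : IsUnit (A + t • 1) := by
  lift t to NNReal using ht.le
  refine ContinuousLinearMap.isUnit_of_forall_le_norm_inner_map _ (c := t) (by exact_mod_cast ht)
    fun x => le_trans ?_ (le_abs_self _)
  have h := hA.inner_nonneg_left x
  simp only [add_apply, smul_apply, one_apply_eq_self, inner_add_left,
    real_inner_smul_left, real_inner_self_eq_norm_sq]
  linarith

theorem add_smul_regInv (hA : A.IsPositive) (ht : 0 < t) (x : E) :
    A (regInv A t x) + t • regInv A t x = x := by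
  have h := Ring.mul_inverse_cancel _ (isUnit_add_smul_one hA ht)
  simpa [regInv] using congrArg (fun M : E →L[ℝ] E => M x) h

theorem regInv_add_smul (hA : A.IsPositive) (ht : 0 < t) (x : E) :
    regInv A t (A x + t • x) = x := by
  have h := Ring.inverse_mul_cancel _ (isUnit_add_smul_one hA ht)
  simpa [regInv] using congrArg (fun M : E →L[ℝ] E => M x) h

theorem regInv_apply_comm (hA : A.IsPositive) (ht : 0 < t) (x : E) :
    regInv A t (A x) = A (regInv A t x) := by
  have h := regInv_add_smul hA ht x
  rw [map_add, map_smul] at h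
  have h' := add_smul_regInv hA ht x
  exact add_right_cancel (h.trans h'.symm)

theorem inner_regInv_left (hA : A.IsPositive) (ht : 0 < t) (x y : E) :
    ⟪regInv A t x, y⟫_ℝ = ⟪x, regInv A t y⟫_ℝ := by
  conv_lhs => rw [← add_smul_regInv hA ht y]
  conv_rhs => rw [← add_smul_regInv hA ht x]
  rw [inner_add_left, inner_add_right, real_inner_smul_left, real_inner_smul_right,
    hA.isSymmetric.apply_clm]

theorem inner_regInv_self (hA : A.IsPositive) (ht : 0 < t) (x : E) :
    ⟪x, regInv A t x⟫_ℝ = ⟪regInv A t x, A (regInv A t x)⟫_ℝ + t * ‖regInv A t x‖ ^ 2 := by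
  conv_lhs => rw [← add_smul_regInv hA ht x]
  rw [regInv_add_smul hA ht, inner_add_left, real_inner_smul_left, real_inner_self_eq_norm_sq,
    real_inner_comm]

theorem mul_norm_sq_regInv_le (hA : A.IsPositive) (ht : 0 < t) (x : E) :
    t * ‖regInv A t x‖ ^ 2 ≤ ⟪x, regInv A t x⟫_ℝ := by
  rw [inner_regInv_self hA ht]
  have := hA.inner_nonneg_right (regInv A t x)
  linarith

theorem mul_norm_regInv_le (hA : A.IsPositive) (ht : 0 < t) (x : E) :
    t * ‖regInv A t x‖ ≤ ‖x‖ := by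
  have h1 := mul_norm_sq_regInv_le hA ht x
  have h2 := real_inner_le_norm x (regInv A t x)
  rcases (norm_nonneg (regInv A t x)).eq_or_lt with h | h
  · rw [← h]; simp
  · nlinarith

/-- The variational lower bound for the quadratic form of `(A + t I)⁻¹`, with equality at
`w = (A + t I)⁻¹ x`. -/
theorem le_inner_regInv (hA : A.IsPositive) (ht : 0 < t) (x w : E) :
    2 * ⟪x, w⟫_ℝ - ⟪w, A w⟫_ℝ - t * ‖w‖ ^ 2 ≤ ⟪x, regInv A t x⟫_ℝ := by
  set u := regInv A t x with hu
  have hx : x = A u + t • u := (add_smul_regInv hA ht x).symm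
  have h1 := hA.inner_nonneg_right (w - u)
  have h2 : 0 ≤ t * ‖w - u‖ ^ 2 := by positivity
  have h3 : ⟪w, A u⟫_ℝ = ⟪u, A w⟫_ℝ := by
    rw [← hA.isSymmetric.apply_clm w u, real_inner_comm]
  have h4 : ⟪x, w⟫_ℝ = ⟪u, A w⟫_ℝ + t * ⟪w, u⟫_ℝ := by
    rw [hx, inner_add_left, real_inner_smul_left, hA.isSymmetric.apply_clm,
      real_inner_comm w u]
  have h5 : ⟪x, u⟫_ℝ = ⟪u, A u⟫_ℝ + t * ‖u‖ ^ 2 := by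
    rw [hu, inner_regInv_self hA ht]
  rw [norm_sub_sq_real] at h2
  rw [map_sub, inner_sub_left, inner_sub_right, inner_sub_right, h3] at h1
  rw [h4, h5]
  nlinarith

/-- The resolvent identity for the parameters `t` and `2t`. -/
theorem regInv_sub_regInv_two_mul (hA : A.IsPositive) (ht : 0 < t) (x : E) :
    regInv A t x - regInv A (2 * t) x = t • regInv A t (regInv A (2 * t) x) := by
  have ht2 : 0 < 2 * t := by positivity
  have h : x = (A (regInv A (2 * t) x) + t • regInv A (2 * t) x) + t • regInv A (2 * t) x := by
    conv_lhs => rw [← add_smul_regInv hA ht2 x]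
    module
  conv_lhs => rw [h]
  rw [map_add, regInv_add_smul hA ht, map_smul, ← h]
  abel

theorem continuous_regInv {V : Type*} [TopologicalSpace V] {F : V → E →L[ℝ] E}
    (hF : Continuous F) (hpos : ∀ v, (F v).IsPositive) (ht : 0 < t) :
    Continuous fun v => regInv (F v) t := by
  rw [continuous_iff_continuousAt]
  intro v
  obtain ⟨u, hu⟩ := isUnit_add_smul_one (hpos v) ht
  have h1 : ContinuousAt Ring.inverse (F v + t • (1 : E →L[ℝ] E)) := by
    rw [← hu]; exact NormedRing.inverse_continuousAt u
  exact ContinuousAt.comp (f := fun v => F v + t • (1 : E →L[ℝ] E)) h1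
    (hF.add continuous_const).continuousAt

end RegularizedInverse

/-! ### Sample covariance and kernel ridge regression in closed form -/

section SampleCovariance

variable {E : Type*} [NormedAddCommGroup E] [InnerProductSpace ℝ E] {ι : Type*}

/-- The sample covariance operator `|s|⁻¹ ∑_{i ∈ s} ⟪v_i, ·⟫ v_i` of a finite family of vectors. -/
def sampleCov (s : Finset ι) (v : ι → E) : E →L[ℝ] E :=
  (s.card : ℝ)⁻¹ • ∑ i ∈ s, InnerProductSpace.rankOne ℝ (v i) (v i)

theorem sampleCov_apply (s : Finset ι) (v : ι → E) (x : E) :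
    sampleCov s v x = (s.card : ℝ)⁻¹ • ∑ i ∈ s, ⟪v i, x⟫_ℝ • v i := by
  simp [sampleCov]

theorem inner_sampleCov (s : Finset ι) (v : ι → E) (x y : E) :
    ⟪x, sampleCov s v y⟫_ℝ = (s.card : ℝ)⁻¹ * ∑ i ∈ s, ⟪v i, x⟫_ℝ * ⟪v i, y⟫_ℝ := by
  simp only [sampleCov_apply, real_inner_smul_right, inner_sum]
  congr 1
  refine Finset.sum_congr rfl fun i _ => ?_
  rw [real_inner_comm x (v i)]; ring

theorem isPositive_sampleCov (s : Finset ι) (v : ι → E) : (sampleCov s v).IsPositive :=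
  ContinuousLinearMap.IsPositive.smul_of_nonneg
    (ContinuousLinearMap.isPositive_sum s fun i _ => InnerProductSpace.isPositive_rankOne_self (v i))
    (by positivity)

theorem continuous_sampleCov (s : Finset ι) : Continuous fun v : ι → E => sampleCov s v := by
  have h : Continuous fun v : ι → E => ∑ i ∈ s, InnerProductSpace.rankOne ℝ (v i) (v i) := by
    refine continuous_finsetSum s fun i _ => ?_
    exact ((InnerProductSpace.rankOne ℝ).continuous.comp (continuous_apply i)).clm_apply
      (continuous_apply i)
  exact h.const_smul (s.card : ℝ)⁻¹

variable [CompleteSpace E]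

/-- The empirical effective dimension `tr ((A + t)⁻¹ A)`, with `A` the sample covariance, is
controlled by `tr ((T + t)⁻¹ T)` and an empirical mean, for every positive operator `T`. This is the
concavity of `A ↦ tr ((A + t)⁻¹ A)`: the tangent at `T` is above the function. The traces are taken
along an orthonormal basis of the finite-dimensional span of the sample. -/
theorem sampleMean_inner_regInv_le {T : E →L[ℝ] E} (hT : T.IsPositive) {t : ℝ} (ht : 0 < t) {C : ℝ}
    (hC : ∀ (k : ℕ) (b : Fin k → E), Orthonormal ℝ b →
      ∑ j, ⟪b j, T (regInv T t (b j))⟫_ℝ ≤ C)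
    {s : Finset ι} (v : ι → E) :
    (s.card : ℝ)⁻¹ * ∑ i ∈ s, ⟪v i, regInv (sampleCov s v) t (v i)⟫_ℝ ≤
      C + t * ((s.card : ℝ)⁻¹ * ∑ i ∈ s, ‖regInv T t (v i)‖ ^ 2) := by
  classical
  set A := sampleCov s v with hAdef
  have hA : A.IsPositive := isPositive_sampleCov s v
  let V : Submodule ℝ E := Submodule.span ℝ (s.image v : Set E)
  let b₀ := stdOrthonormalBasis ℝ V
  let b : Fin (Module.finrank ℝ V) → E := fun j => b₀ j
  have hb : Orthonormal ℝ b := b₀.orthonormal.comp_linearIsometry V.subtypeₗᵢ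
  -- Parseval's identity in the span of the sample.
  have hpars : ∀ i ∈ s, ∀ y, ∑ j, ⟪v i, b j⟫_ℝ * ⟪b j, y⟫_ℝ = ⟪v i, y⟫_ℝ := by
    intro i hi y
    have hv : v i ∈ V := Submodule.subset_span (by simpa using ⟨i, hi, rfl⟩)
    have h := congrArg (fun w : V => ⟪(w : E), y⟫_ℝ) (b₀.sum_repr' ⟨v i, hv⟩)
    simp only [Submodule.coe_sum, Submodule.coe_smul, sum_inner, real_inner_smul_left,
      Submodule.coe_inner] at h
    rw [← h]
    refine Finset.sum_congr rfl fun j _ => ?_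
    rw [real_inner_comm]
  have htrace : (s.card : ℝ)⁻¹ * ∑ i ∈ s, ⟪v i, regInv A t (v i)⟫_ℝ =
      ∑ j, ⟪b j, A (regInv A t (b j))⟫_ℝ := by
    simp_rw [hAdef, inner_sampleCov, ← Finset.mul_sum]
    rw [Finset.sum_comm]
    congr 1
    refine Finset.sum_congr rfl fun i hi => ?_
    rw [← hpars i hi]
    refine Finset.sum_congr rfl fun j _ => ?_
    rw [← inner_regInv_left hA ht (v i) (b j), real_inner_comm (b j) (regInv A t (v i))]
  have hterm : ∀ j, ⟪b j, A (regInv A t (b j))⟫_ℝ ≤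
      ⟪b j, T (regInv T t (b j))⟫_ℝ +
        t * ((s.card : ℝ)⁻¹ * ∑ i ∈ s, ⟪b j, regInv T t (v i)⟫_ℝ ^ 2) := by
    intro j
    set w := regInv T t (b j) with hw
    have h1 : A (regInv A t (b j)) = b j - t • regInv A t (b j) :=
      eq_sub_of_add_eq (add_smul_regInv hA ht (b j))
    have h2 : T w = b j - t • w := eq_sub_of_add_eq (add_smul_regInv hT ht (b j))
    have h3 := le_inner_regInv hA ht (b j) w
    have h4 := mul_norm_sq_regInv_le hT ht (b j)
    have h5 : ⟪w, A w⟫_ℝ = (s.card : ℝ)⁻¹ * ∑ i ∈ s, ⟪b j, regInv T t (v i)⟫_ℝ ^ 2 := by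
      rw [hAdef, inner_sampleCov]
      congr 1
      refine Finset.sum_congr rfl fun i _ => ?_
      rw [hw, ← inner_regInv_left hT ht (v i) (b j), real_inner_comm (b j) (regInv T t (v i)), sq]
    rw [h1, h2, inner_sub_right, inner_sub_right, real_inner_smul_right, real_inner_smul_right,
      ← h5]
    rw [← hw] at h4
    nlinarith
  rw [htrace]
  refine (Finset.sum_le_sum fun j _ => hterm j).trans ?_
  rw [Finset.sum_add_distrib]
  refine add_le_add (hC _ b hb) ?_
  rw [← Finset.mul_sum, ← Finset.mul_sum, Finset.sum_comm]
  gcongr with i _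
  simpa using hb.sum_inner_products_le (s := Finset.univ) (regInv T t (v i))

end SampleCovariance

section Estimator

variable {X : Type*} {H : Type*} [NormedAddCommGroup H] [InnerProductSpace ℝ H]
  [CompleteSpace H] [RKHS ℝ H X ℝ] {ι : Type*}

/-- The normal equations: kernel ridge regression in closed form. -/
theorem krr_eq (s : Finset ι) (z : ι → X × ℝ) {t : ℝ} (ht : 0 < t) :
    krr H s z t = regInv (sampleCov s fun i => kernelSection H (z i).1) t
      ((s.card : ℝ)⁻¹ • ∑ i ∈ s, (z i).2 • kernelSection H (z i).1) := by
  set v : ι → H := fun i => kernelSection H (z i).1 with hv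
  set A := sampleCov s v with hAdef
  have hA : A.IsPositive := isPositive_sampleCov s v
  set p : H := (s.card : ℝ)⁻¹ • ∑ i ∈ s, (z i).2 • v i with hp
  set F := regInv A t p with hF
  have key : ∀ g : H, krrObjective s z t F + t * ‖g - F‖ ^ 2 ≤ krrObjective s z t g := by
    intro g
    have h0 : A F + t • F = p := add_smul_regInv hA ht p
    have h1 : ⟪g - F, A F⟫_ℝ + t * ⟪g - F, F⟫_ℝ = ⟪g - F, p⟫_ℝ := by
      rw [← h0, inner_add_right, real_inner_smul_right]
    rw [hAdef, inner_sampleCov, hp, real_inner_smul_right, inner_sum] at h1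
    have h2 : ‖g‖ ^ 2 = ‖F‖ ^ 2 + 2 * ⟪g - F, F⟫_ℝ + ‖g - F‖ ^ 2 := by
      conv_lhs => rw [← sub_add_cancel g F]
      rw [norm_add_sq_real]; ring
    have h3 : ∀ i ∈ s, (F (z i).1 - (z i).2) ^ 2 + 2 * (⟪v i, g - F⟫_ℝ * ⟪v i, F⟫_ℝ)
        - 2 * ⟪g - F, (z i).2 • v i⟫_ℝ ≤ (g (z i).1 - (z i).2) ^ 2 := by
      intro i _
      rw [real_inner_smul_right, real_inner_comm, real_inner_comm _ (v i), inner_sub_left]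
      simp only [hv, inner_kernelSection]
      nlinarith [sq_nonneg (g (z i).1 - F (z i).1)]
    have h4 := Finset.sum_le_sum h3
    rw [Finset.sum_sub_distrib, Finset.sum_add_distrib, ← Finset.mul_sum, ← Finset.mul_sum] at h4
    have h5 := mul_le_mul_of_nonneg_left h4 (show 0 ≤ (s.card : ℝ)⁻¹ by positivity)
    unfold krrObjective
    rw [h2, one_div]
    nlinarith
  have hmin : ∀ g : H, krrObjective s z t F ≤ krrObjective s z t g := fun g =>
    le_trans (by nlinarith [mul_nonneg ht.le (sq_nonneg ‖g - F‖)]) (key g)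
  have hspec : ∀ g : H, krrObjective s z t (krr H s z t) ≤ krrObjective s z t g :=
    Classical.epsilon_spec (p := fun f : H => ∀ g : H, krrObjective s z t f ≤ krrObjective s z t g)
      ⟨F, hmin⟩
  have h1 := key (krr H s z t)
  have h2 := hspec F
  have h3 : t * ‖krr H s z t - F‖ ^ 2 ≤ 0 := by linarith
  have h4 : ‖krr H s z t - F‖ ^ 2 ≤ 0 := nonpos_of_mul_nonpos_right h3 ht
  have h5 : ‖krr H s z t - F‖ = 0 := by
    have := sq_nonneg ‖krr H s z t - F‖
    exact pow_eq_zero_iff two_ne_zero |>.1 (le_antisymm h4 this)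
  exact sub_eq_zero.1 (norm_eq_zero.1 h5)

/-- Decomposition of the estimation error into the noise and the regularization bias. -/
theorem krr_sub_eq (s : Finset ι) (z : ι → X × ℝ) {t : ℝ} (ht : 0 < t) (f : H) :
    krr H s z t - f = regInv (sampleCov s fun i => kernelSection H (z i).1) t
        ((s.card : ℝ)⁻¹ • ∑ i ∈ s, ((z i).2 - f (z i).1) • kernelSection H (z i).1) -
      t • regInv (sampleCov s fun i => kernelSection H (z i).1) t f := by
  have h := regInv_add_smul (isPositive_sampleCov s fun i => kernelSection H (z i).1) ht f
  conv_lhs => rw [← h]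
  rw [krr_eq s z ht, map_add, map_smul _ t f, sampleCov_apply, sub_add_eq_sub_sub, ← map_sub, ← smul_sub,
    ← Finset.sum_sub_distrib]
  simp only [sub_smul, real_inner_comm f, inner_kernelSection]

/-- The regularization bias `t (A + t)⁻¹ f` for the sample covariance `A` is small if `f` is close to
the range of an operator `T` which is close to `A`. -/
theorem norm_smul_regInv_le {A : H →L[ℝ] H} (hA : A.IsPositive) (T : H →L[ℝ] H) {t : ℝ} (ht : 0 < t)
    (f g : H) : ‖t • regInv A t f‖ ≤ ‖f - T g‖ + t * ‖g‖ + ‖A g - T g‖ := by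
  have h1 : t • regInv A t f = t • regInv A t (f - T g) + t • regInv A t (A g) -
      t • regInv A t (A g - T g) := by
    rw [← smul_add, ← smul_sub, ← map_add, ← map_sub]; congr 2; abel
  have hle : ∀ x : H, ‖t • regInv A t x‖ ≤ ‖x‖ := fun x => by
    rw [norm_smul, Real.norm_of_nonneg ht.le]; exact mul_norm_regInv_le hA ht x
  have h2 : ‖regInv A t (A g)‖ ≤ ‖g‖ := by
    have h3 : regInv A t (A g) = g - t • regInv A t g := by
      rw [regInv_apply_comm hA ht]; exact eq_sub_of_add_eq (add_smul_regInv hA ht g)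
    have h4 := mul_norm_sq_regInv_le hA ht g
    have h5 : ‖regInv A t (A g)‖ ^ 2 ≤ ‖g‖ ^ 2 := by
      rw [h3, norm_sub_sq_real, real_inner_smul_right, norm_smul, Real.norm_of_nonneg ht.le]
      have h6 : 0 ≤ ⟪g, regInv A t g⟫_ℝ := le_trans (by positivity) h4
      nlinarith
    exact (sq_le_sq₀ (norm_nonneg _) (norm_nonneg _)).1 h5
  rw [h1]
  refine (norm_sub_le _ _).trans (add_le_add ((norm_add_le _ _).trans (add_le_add (hle _) ?_))
    (hle _))
  rw [norm_smul, Real.norm_of_nonneg ht.le]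
  gcongr

end Estimator

/-! ### The covariance operator and the effective dimension -/

section Parseval

variable {E : Type*} [NormedAddCommGroup E] [InnerProductSpace ℝ E]

theorem tsum_ofReal_inner_sq {ι : Type*} (b : HilbertBasis ι ℝ E) (x : E) :
    ∑' i, ENNReal.ofReal (⟪b i, x⟫_ℝ ^ 2) = ENNReal.ofReal (‖x‖ ^ 2) := by
  have h := b.hasSum_inner_mul_inner x x
  simp_rw [fun i => real_inner_comm (b i) x, ← sq, real_inner_self_eq_norm_sq] at h
  rw [← h.tsum_eq, ENNReal.ofReal_tsum_of_nonneg (fun i => sq_nonneg _) h.summable]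

theorem tsum_ofReal_inner_sq_le {ι : Type*} {b : ι → E} (hb : Orthonormal ℝ b) (x : E) :
    ∑' i, ENNReal.ofReal (⟪b i, x⟫_ℝ ^ 2) ≤ ENNReal.ofReal (‖x‖ ^ 2) := by
  rw [ENNReal.tsum_eq_iSup_sum]
  refine iSup_le fun s => ?_
  rw [← ENNReal.ofReal_sum_of_nonneg fun i _ => sq_nonneg _]
  exact ENNReal.ofReal_le_ofReal (by simpa using hb.sum_inner_products_le (s := s) x)

theorem countable_of_orthonormal [TopologicalSpace.SeparableSpace E] {ι : Type*} {b : ι → E}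
    (hb : Orthonormal ℝ b) : Countable ι := by
  refine Pairwise.countable_of_isOpen_disjoint (s := fun i => Metric.ball (b i) (1 / 2)) ?_
    (fun i => Metric.isOpen_ball) fun i => ⟨b i, by simp⟩
  intro i j hij
  refine Metric.ball_disjoint_ball ?_
  have h : dist (b i) (b j) ^ 2 = 2 := by
    rw [dist_eq_norm, norm_sub_sq_real, hb.1 i, hb.1 j, hb.2 hij]; norm_num
  nlinarith [dist_nonneg (x := b i) (y := b j)]

/-- The values of a strongly measurable function are almost surely expanded by one countable
orthonormal family, even in a nonseparable Hilbert space. -/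
theorem exists_countable_orthonormal_parseval [CompleteSpace E] {X : Type*} [MeasurableSpace X]
    {ρ : Measure X} {F : X → E} (hF : AEStronglyMeasurable F ρ) :
    ∃ (w : Set E), Countable w ∧ Orthonormal ℝ ((↑) : w → E) ∧ ∀ᵐ x ∂ρ,
      ∑' e : w, ENNReal.ofReal (⟪(e : E), F x⟫_ℝ ^ 2) = ENNReal.ofReal (‖F x‖ ^ 2) := by
  obtain ⟨u, hu, hFu⟩ := hF.isSeparable_ae_range
  let V : Submodule ℝ E := (Submodule.span ℝ u).topologicalClosure
  have hV : TopologicalSpace.IsSeparable (V : Set E) := by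
    rw [Submodule.topologicalClosure_coe]; exact hu.span.closure
  have : TopologicalSpace.SeparableSpace V := hV.separableSpace
  have : CompleteSpace V := (Submodule.isClosed_topologicalClosure _).completeSpace_coe
  obtain ⟨w₀, b, hb⟩ := exists_hilbertBasis ℝ V
  have hw₀ : Countable w₀ := countable_of_orthonormal b.orthonormal
  have hon : Orthonormal ℝ fun e : w₀ => ((e : V) : E) := by
    have := b.orthonormal.comp_linearIsometry V.subtypeₗᵢ
    rwa [hb] at this
  have hinj : Function.Injective fun e : w₀ => ((e : V) : E) :=
    Subtype.val_injective.comp Subtype.val_injective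
  refine ⟨Set.range fun e : w₀ => ((e : V) : E), Set.countable_range _, hon.toSubtypeRange, ?_⟩
  filter_upwards [hFu] with x hx
  have hxV : F x ∈ V := Submodule.le_topologicalClosure _ (Submodule.subset_span hx)
  have h := tsum_ofReal_inner_sq b ⟨F x, hxV⟩
  rw [hb] at h
  rw [← (Equiv.ofInjective _ hinj).tsum_eq]
  simpa using h

end Parseval

section Population

variable {X : Type*} {H : Type*} [NormedAddCommGroup H] [InnerProductSpace ℝ H]
  [CompleteSpace H] [RKHS ℝ H X ℝ] [MeasurableSpace X] {ρ : Measure X} [IsProbabilityMeasure ρ]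
  {κ : ℝ} (hK : BoundedKernel H ρ κ)

theorem integralOp_apply (g : Lp ℝ 2 ρ) :
    integralOp hK g = ∫ x, g x • kernelSection H x ∂ρ := rfl

theorem inclusion_coeFn (f : H) : inclusion hK f =ᵐ[ρ] fun x => f x :=
  (hK.memLp f).coeFn_toLp

/-- The inclusion `H_K → L²` is the adjoint of the integral operator. -/
theorem inner_inclusion_left (f : H) (g : Lp ℝ 2 ρ) :
    ⟪inclusion hK f, g⟫_ℝ = ⟪f, integralOp hK g⟫_ℝ := by
  rw [L2.inner_def, integralOp_apply, ← integral_inner (hK.integrable_smul g)]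
  refine integral_congr_ae ?_
  filter_upwards [inclusion_coeFn hK f] with x hx
  rw [hx, real_inner_smul_right, inner_kernelSection]
  simp

theorem norm_sq_inclusion (f : H) :
    ‖inclusion hK f‖ ^ 2 = ∫ x, ⟪kernelSection H x, f⟫_ℝ ^ 2 ∂ρ := by
  rw [← real_inner_self_eq_norm_sq, L2.inner_def]
  refine integral_congr_ae ?_
  filter_upwards [inclusion_coeFn hK f] with x hx
  rw [hx, real_inner_self_eq_norm_sq, Real.norm_eq_abs, sq_abs,
    real_inner_comm f (kernelSection H x), inner_kernelSection]

/-- The covariance operator `f ↦ ∫ f(x) K_x dρ(x)` on `H_K`. -/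
def covOp : H →L[ℝ] H := integralOp hK ∘L inclusion hK

theorem covOp_apply (f : H) : covOp hK f = ∫ x, ⟪kernelSection H x, f⟫_ℝ • kernelSection H x ∂ρ := by
  change ∫ x, inclusion hK f x • kernelSection H x ∂ρ = _
  refine integral_congr_ae ?_
  filter_upwards [inclusion_coeFn hK f] with x hx
  rw [hx, real_inner_comm, inner_kernelSection]

theorem inner_covOp (f g : H) : ⟪f, covOp hK g⟫_ℝ = ⟪inclusion hK f, inclusion hK g⟫_ℝ :=
  (inner_inclusion_left hK f (inclusion hK g)).symm

theorem isPositive_covOp : (covOp hK).IsPositive := by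
  rw [ContinuousLinearMap.isPositive_def]
  refine ⟨fun f g => ?_, fun f => ?_⟩
  · change ⟪covOp hK f, g⟫_ℝ = ⟪f, covOp hK g⟫_ℝ
    rw [real_inner_comm, inner_covOp, inner_covOp, real_inner_comm]
  · change 0 ≤ ⟪covOp hK f, f⟫_ℝ
    rw [real_inner_comm, inner_covOp]
    exact real_inner_self_nonneg

theorem isPositive_integralOpL2 : (integralOpL2 hK).IsPositive := by
  have h : ∀ g g' : Lp ℝ 2 ρ,
      ⟪integralOpL2 hK g, g'⟫_ℝ = ⟪integralOp hK g, integralOp hK g'⟫_ℝ := fun g g' =>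
    inner_inclusion_left hK _ _
  rw [ContinuousLinearMap.isPositive_def]
  refine ⟨fun g g' => ?_, fun g => ?_⟩
  · change ⟪integralOpL2 hK g, g'⟫_ℝ = ⟪g, integralOpL2 hK g'⟫_ℝ
    rw [h, real_inner_comm _ g, h, real_inner_comm]
  · change 0 ≤ ⟪integralOpL2 hK g, g⟫_ℝ
    rw [h]
    exact real_inner_self_nonneg

/-- `(L_K + t)⁻¹ L_K = ι (T + t)⁻¹ L_K`, where `T` is the covariance operator on `H_K` and `ι` is the
inclusion of `H_K` in `L²`. -/
theorem inverse_mul_integralOpL2_apply {t : ℝ} (ht : 0 < t) (g : Lp ℝ 2 ρ) :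
    (Ring.inverse (integralOpL2 hK + t • 1) * integralOpL2 hK) g =
      inclusion hK (regInv (covOp hK) t (integralOp hK g)) := by
  have h1 := add_smul_regInv (isPositive_covOp hK) ht (integralOp hK g)
  set u := regInv (covOp hK) t (integralOp hK g)
  have h2 : integralOpL2 hK g =
      integralOpL2 hK (inclusion hK u) + t • inclusion hK u := by
    change inclusion hK (integralOp hK g) = inclusion hK (covOp hK u) + _
    rw [← h1, map_add, map_smul]
  change regInv (integralOpL2 hK) t (integralOpL2 hK g) = _
  rw [h2, regInv_add_smul (isPositive_integralOpL2 hK) ht]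

theorem integrable_norm_sq_kernelSection (hK : BoundedKernel H ρ κ) (M : H →L[ℝ] H) :
    Integrable (fun x => ‖M (kernelSection H x)‖ ^ 2) ρ := by
  refine Integrable.of_bound (C := (‖M‖ * κ) ^ 2)
    ((M.continuous.comp_aestronglyMeasurable hK.aestronglyMeasurable).norm.pow 2)
    (Eventually.of_forall fun x => ?_)
  rw [Real.norm_of_nonneg (by positivity)]
  gcongr
  exact (M.le_opNorm _).trans (by gcongr; exact hK.norm_kernelSection_le x)

theorem integrable_inner_kernelSection_sq (hK : BoundedKernel H ρ κ) (f : H) :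
    Integrable (fun x => ⟪kernelSection H x, f⟫_ℝ ^ 2) ρ := by
  refine ((hK.memLp f).integrable_sq).congr (Eventually.of_forall fun x => ?_)
  change f x ^ 2 = ⟪kernelSection H x, f⟫_ℝ ^ 2
  rw [real_inner_comm, inner_kernelSection]

/-- The mean square of `(T + t)⁻¹ K_x` is bounded by the effective dimension. -/
theorem mul_integral_norm_sq_regInv_le {t D : ℝ} (ht : 0 < t) (hD0 : 0 ≤ D)
    (hD : effectiveDim hK t ≤ ENNReal.ofReal D) :
    t * ∫ x, ‖regInv (covOp hK) t (kernelSection H x)‖ ^ 2 ∂ρ ≤ D := by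
  set R := regInv (covOp hK) t with hR
  have hT := isPositive_covOp hK
  obtain ⟨w, hwc, hw, hpars⟩ := exists_countable_orthonormal_parseval
    (R.continuous.comp_aestronglyMeasurable hK.aestronglyMeasurable)
  set W := (exists_hilbertBasis ℝ (Lp ℝ 2 ρ)).choose
  obtain ⟨b, hb⟩ := (exists_hilbertBasis ℝ (Lp ℝ 2 ρ)).choose_spec
  have hb' : ∀ e : W, b e = (e : Lp ℝ 2 ρ) := fun e => congrFun hb e
  have h1 : ENNReal.ofReal (∫ x, ‖R (kernelSection H x)‖ ^ 2 ∂ρ) ≤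
      ∑' e : W, ENNReal.ofReal (‖R (integralOp hK (e : Lp ℝ 2 ρ))‖ ^ 2) := by
    calc ENNReal.ofReal (∫ x, ‖R (kernelSection H x)‖ ^ 2 ∂ρ)
        = ∫⁻ x, ENNReal.ofReal (‖R (kernelSection H x)‖ ^ 2) ∂ρ :=
          ofReal_integral_eq_lintegral_ofReal (integrable_norm_sq_kernelSection hK R)
            (Eventually.of_forall fun x => sq_nonneg _)
      _ = ∫⁻ x, ∑' e : w, ENNReal.ofReal (⟪kernelSection H x, R (e : H)⟫_ℝ ^ 2) ∂ρ := by
          refine lintegral_congr_ae ?_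
          filter_upwards [hpars] with x hx
          rw [← hx]
          refine tsum_congr fun e => ?_
          rw [real_inner_comm, hR, inner_regInv_left hT ht]
      _ = ∑' e : w, ∫⁻ x, ENNReal.ofReal (⟪kernelSection H x, R (e : H)⟫_ℝ ^ 2) ∂ρ :=
          lintegral_tsum fun e =>
            (integrable_inner_kernelSection_sq hK _).aestronglyMeasurable.aemeasurable.ennreal_ofReal
      _ = ∑' e : w, ∑' e' : W,
            ENNReal.ofReal (⟪(e : H), R (integralOp hK (e' : Lp ℝ 2 ρ))⟫_ℝ ^ 2) := by
          refine tsum_congr fun e => ?_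
          rw [← ofReal_integral_eq_lintegral_ofReal (integrable_inner_kernelSection_sq hK _)
            (Eventually.of_forall fun x => sq_nonneg _), ← norm_sq_inclusion,
            ← tsum_ofReal_inner_sq b]
          refine tsum_congr fun e' => ?_
          rw [hb', real_inner_comm, inner_inclusion_left, hR, inner_regInv_left hT ht]
      _ = ∑' e' : W, ∑' e : w,
            ENNReal.ofReal (⟪(e : H), R (integralOp hK (e' : Lp ℝ 2 ρ))⟫_ℝ ^ 2) :=
          ENNReal.tsum_comm
      _ ≤ _ := ENNReal.tsum_le_tsum fun e' => tsum_ofReal_inner_sq_le hw _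
  have h2 : ENNReal.ofReal t *
      ∑' e : W, ENNReal.ofReal (‖R (integralOp hK (e : Lp ℝ 2 ρ))‖ ^ 2) ≤ effectiveDim hK t := by
    rw [effectiveDim, posTrace, ← ENNReal.tsum_mul_left]
    refine ENNReal.tsum_le_tsum fun e => ?_
    rw [← ENNReal.ofReal_mul ht.le, inverse_mul_integralOpL2_apply hK ht, real_inner_comm,
      inner_inclusion_left, real_inner_comm]
    exact ENNReal.ofReal_le_ofReal (mul_norm_sq_regInv_le hT ht _)
  have h3 : ENNReal.ofReal (t * ∫ x, ‖R (kernelSection H x)‖ ^ 2 ∂ρ) ≤ ENNReal.ofReal D := by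
    rw [ENNReal.ofReal_mul ht.le]
    exact (mul_le_mul_right h1 _).trans (h2.trans hD)
  exact (ENNReal.ofReal_le_ofReal_iff hD0).1 h3

/-- Bessel's inequality, integrated: the Hilbert-Schmidt norm of `ι (T + t)⁻¹`. -/
theorem sum_norm_sq_inclusion_regInv_le {t : ℝ} (ht : 0 < t) {k : ℕ} {b : Fin k → H}
    (hb : Orthonormal ℝ b) :
    ∑ j, ‖inclusion hK (regInv (covOp hK) t (b j))‖ ^ 2 ≤
      ∫ x, ‖regInv (covOp hK) t (kernelSection H x)‖ ^ 2 ∂ρ := by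
  simp_rw [norm_sq_inclusion]
  rw [← integral_finsetSum _ fun j _ => integrable_inner_kernelSection_sq hK _]
  refine integral_mono (integrable_finsetSum _ fun j _ => integrable_inner_kernelSection_sq hK _)
    (integrable_norm_sq_kernelSection hK _) fun x => ?_
  simp_rw [← inner_regInv_left (isPositive_covOp hK) ht]
  simpa [real_inner_comm] using hb.sum_inner_products_le (s := Finset.univ)
    (regInv (covOp hK) t (kernelSection H x))

/-- The trace of `(T + t)⁻¹ T` is of the order `t ^ (-α)` if the effective dimension is. The trace is
bounded without diagonalizing `T`, by telescoping over the parameters `t, 2t, 4t, …`: consecutive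
terms differ by `t T (T + t)⁻¹ (T + 2t)⁻¹`, and the Hilbert-Schmidt norms of both factors
`ι (T + t)⁻¹`, `ι (T + 2t)⁻¹` are known. -/
theorem sum_inner_covOp_regInv_le {α Q : ℝ} (hα : 0 < α) (hQ : 0 ≤ Q)
    (hdim : ∀ t : ℝ, 0 < t → effectiveDim hK t ≤ ENNReal.ofReal (Q * t ^ (-α)))
    {t : ℝ} (ht : 0 < t) {k : ℕ} {b : Fin k → H} (hb : Orthonormal ℝ b) :
    ∑ j, ⟪b j, covOp hK (regInv (covOp hK) t (b j))⟫_ℝ ≤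
      Q / (1 - 2 ^ (-α)) * t ^ (-α) := by
  have hT := isPositive_covOp hK
  set τ : ℝ → ℝ := fun t => ∑ j, ⟪b j, covOp hK (regInv (covOp hK) t (b j))⟫_ℝ with hτ
  have hd : ∀ t : ℝ, 0 < t →
      t * ∑ j, ‖inclusion hK (regInv (covOp hK) t (b j))‖ ^ 2 ≤ Q * t ^ (-α) := fun t ht =>
    (mul_le_mul_of_nonneg_left (sum_norm_sq_inclusion_regInv_le hK ht hb) ht.le).trans
      (mul_integral_norm_sq_regInv_le hK ht (by positivity) (hdim t ht))
  have hq0 : (0 : ℝ) < 2 ^ (-α) := by positivity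
  have hq1 : (2 : ℝ) ^ (-α) < 1 := Real.rpow_lt_one_of_one_lt_of_neg one_lt_two (by linarith)
  have hstep : ∀ t : ℝ, 0 < t → τ t ≤ τ (2 * t) + Q * t ^ (-α) := by
    intro t ht
    have ht2 : 0 < 2 * t := by positivity
    have h1 : ∀ j, ⟪b j, covOp hK (regInv (covOp hK) t (b j))⟫_ℝ ≤
        ⟪b j, covOp hK (regInv (covOp hK) (2 * t) (b j))⟫_ℝ +
        (t / 2 * ‖inclusion hK (regInv (covOp hK) t (b j))‖ ^ 2 +
          t / 2 * ‖inclusion hK (regInv (covOp hK) (2 * t) (b j))‖ ^ 2) := by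
      intro j
      have h2 := congrArg (fun y => ⟪b j, covOp hK y⟫_ℝ)
        (regInv_sub_regInv_two_mul hT ht (b j))
      simp only [map_sub, inner_sub_right, map_smul, real_inner_smul_right] at h2
      rw [← regInv_apply_comm hT ht (regInv (covOp hK) (2 * t) (b j)),
        ← inner_regInv_left hT ht, inner_covOp _ (regInv _ t _)] at h2
      have h3 := real_inner_le_norm (inclusion hK (regInv (covOp hK) t (b j)))
        (inclusion hK (regInv (covOp hK) (2 * t) (b j)))
      have h4 := two_mul_le_add_sq ‖inclusion hK (regInv (covOp hK) t (b j))‖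
        ‖inclusion hK (regInv (covOp hK) (2 * t) (b j))‖
      nlinarith
    have h5 := Finset.sum_le_sum fun j (_ : j ∈ Finset.univ) => h1 j
    rw [Finset.sum_add_distrib, Finset.sum_add_distrib, ← Finset.mul_sum, ← Finset.mul_sum] at h5
    have h6 := hd t ht
    have h7 := hd (2 * t) ht2
    rw [Real.mul_rpow zero_le_two ht.le] at h7
    have h8 : Q * (2 ^ (-α) * t ^ (-α)) ≤ Q * t ^ (-α) := by
      refine mul_le_mul_of_nonneg_left ?_ hQ
      exact mul_le_of_le_one_left (by positivity) hq1.le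
    have h9 : 0 ≤ Q * t ^ (-α) := by positivity
    simp only [hτ]
    linarith
  set C := Q / (1 - 2 ^ (-α)) with hC
  have hC0 : 0 ≤ C := div_nonneg hQ (by linarith)
  have hCQ : C * (1 - 2 ^ (-α)) = Q := div_mul_cancel₀ _ (by linarith)
  have hiter : ∀ (J : ℕ) (t : ℝ), 0 < t → τ t ≤ τ (2 ^ J * t) + C * t ^ (-α) := by
    intro J
    induction J with
    | zero => intro t ht; simpa using (by positivity : 0 ≤ C * t ^ (-α))
    | succ J ih =>
      intro t ht
      have h1 := hstep t ht
      have h2 := ih (2 * t) (by positivity)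
      rw [Real.mul_rpow zero_le_two ht.le] at h2
      rw [pow_succ, mul_assoc]
      rw [← hCQ] at h1
      linarith
  have htail : ∀ t : ℝ, 0 < t → τ t ≤ k * ‖covOp hK‖ / t := by
    intro t ht
    have h1 : ∀ j, ⟪b j, covOp hK (regInv (covOp hK) t (b j))⟫_ℝ ≤ ‖covOp hK‖ / t := by
      intro j
      have h2 := mul_norm_regInv_le hT ht (b j)
      rw [hb.1 j] at h2
      calc ⟪b j, covOp hK (regInv (covOp hK) t (b j))⟫_ℝ
          ≤ ‖b j‖ * ‖covOp hK (regInv (covOp hK) t (b j))‖ := real_inner_le_norm _ _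
        _ ≤ ‖covOp hK‖ * ‖regInv (covOp hK) t (b j)‖ := by
            rw [hb.1 j, one_mul]; exact (covOp hK).le_opNorm _
        _ ≤ ‖covOp hK‖ * (1 / t) := by
            gcongr
            rw [le_div_iff₀ ht, mul_comm]; exact h2
        _ = ‖covOp hK‖ / t := by ring
    calc τ t ≤ ∑ _j : Fin k, ‖covOp hK‖ / t := Finset.sum_le_sum fun j _ => h1 j
      _ = k * ‖covOp hK‖ / t := by simp; ring
  have hlim : Tendsto (fun J : ℕ => k * ‖covOp hK‖ / (2 ^ J * t) + C * t ^ (-α)) atTop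
      (𝓝 (0 + C * t ^ (-α))) := by
    refine Tendsto.add_const _ (Tendsto.div_atTop tendsto_const_nhds ?_)
    exact (tendsto_pow_atTop_atTop_of_one_lt one_lt_two).atTop_mul_const ht
  rw [zero_add] at hlim
  refine ge_of_tendsto' hlim fun J => (hiter J t ht).trans ?_
  gcongr
  exact htail _ (by positivity)

/-- The range of the covariance operator is dense in the range of the integral operator. -/
theorem integralOp_mem_closure_range (g : Lp ℝ 2 ρ) :
    integralOp hK g ∈ (LinearMap.range (covOp hK).toLinearMap).topologicalClosure := by
  rw [← Submodule.orthogonal_orthogonal_eq_closure, Submodule.mem_orthogonal]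
  intro h hh
  have h1 : ⟪covOp hK h, h⟫_ℝ = 0 := (Submodule.mem_orthogonal _ _).1 hh _ ⟨h, rfl⟩
  rw [real_inner_comm, inner_covOp, inner_self_eq_zero] at h1
  rw [← inner_inclusion_left, h1, inner_zero_left]

/-- The powers of the integral operator take values in the closure of the range of the covariance
operator, where the regularization bias vanishes as `t → 0`. -/
theorem integralOpPow_mem_closure_range (r : ℝ) (g : Lp ℝ 2 ρ) :
    integralOpPow hK r g ∈ (LinearMap.range (covOp hK).toLinearMap).topologicalClosure := by
  unfold integralOpPow
  exact tsum_mem (Submodule.isClosed_topologicalClosure _)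
    fun t => Submodule.smul_mem _ _ (integralOp_mem_closure_range hK _)

end Population

/-! ### Product measures, residuals and the law of large numbers -/

section ProductMeasure

theorem aestronglyMeasurable_pi {Ω : Type*} [MeasurableSpace Ω] {P : Measure Ω} {ι : Type*}
    [Fintype ι] {E : Type*} [NormedAddCommGroup E] {F : ι → Ω → E}
    (hF : ∀ i, AEStronglyMeasurable (F i) P) :
    AEStronglyMeasurable (fun ω i => F i ω) P := by
  classical
  have h : (fun ω i => F i ω) = fun ω => ∑ i, Pi.single (M := fun _ : ι => E) i (F i ω) := by
    funext ω
    exact (Finset.univ_sum_single fun i => F i ω).symm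
  rw [h]
  exact Finset.aestronglyMeasurable_fun_sum _ fun i _ =>
    (continuous_single i).comp_aestronglyMeasurable (hF i)

/-- Integration over a finite product, one coordinate first. -/
theorem integral_pi_eq_integral_insertNth {Z : Type*} [MeasurableSpace Z] {μ : Measure Z}
    [IsProbabilityMeasure μ] {n : ℕ} (i : Fin (n + 1)) {G : (Fin (n + 1) → Z) → ℝ}
    (hG : Integrable G (Measure.pi fun _ => μ)) :
    ∫ z, G z ∂(Measure.pi fun _ => μ) =
      ∫ z', ∫ w, G (i.insertNth w z') ∂μ ∂(Measure.pi fun _ : Fin n => μ) := by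
  have hmp := (measurePreserving_piFinSuccAbove (fun _ : Fin (n + 1) => μ) i).symm
  exact (hmp.integral_comp' G).symm.trans
    (integral_prod_symm _ (hmp.integrable_comp_of_integrable hG))

/-- The norm of an average of vectors that are pairwise orthogonal in the mean. -/
theorem integral_norm_sq_average {Ω : Type*} [MeasurableSpace Ω] {P : Measure Ω}
    {E : Type*} [NormedAddCommGroup E] [InnerProductSpace ℝ E] {ι : Type*} {s : Finset ι}
    {ξ : ι → Ω → E}
    (hint : ∀ i j, Integrable (fun ω => ⟪ξ i ω, ξ j ω⟫_ℝ) P)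
    (hcross : ∀ i j, i ≠ j → ∫ ω, ⟪ξ i ω, ξ j ω⟫_ℝ ∂P = 0) :
    Integrable (fun ω => ‖(s.card : ℝ)⁻¹ • ∑ i ∈ s, ξ i ω‖ ^ 2) P ∧
    ∫ ω, ‖(s.card : ℝ)⁻¹ • ∑ i ∈ s, ξ i ω‖ ^ 2 ∂P =
      (s.card : ℝ)⁻¹ ^ 2 * ∑ i ∈ s, ∫ ω, ‖ξ i ω‖ ^ 2 ∂P := by
  have h : ∀ ω, ‖(s.card : ℝ)⁻¹ • ∑ i ∈ s, ξ i ω‖ ^ 2 =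
      (s.card : ℝ)⁻¹ ^ 2 * ∑ i ∈ s, ∑ j ∈ s, ⟪ξ i ω, ξ j ω⟫_ℝ := by
    intro ω
    rw [norm_smul, mul_pow, Real.norm_eq_abs, sq_abs, ← real_inner_self_eq_norm_sq, sum_inner]
    simp_rw [inner_sum]
  simp_rw [h]
  have hint' : ∀ i, Integrable (fun ω => ∑ j ∈ s, ⟪ξ i ω, ξ j ω⟫_ℝ) P := fun i =>
    integrable_finsetSum _ fun j _ => hint i j
  refine ⟨(integrable_finsetSum _ fun i _ => hint' i).const_mul _, ?_⟩
  rw [integral_const_mul, integral_finsetSum _ fun i _ => hint' i]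
  congr 1
  refine Finset.sum_congr rfl fun i hi => ?_
  rw [integral_finsetSum _ fun j _ => hint i j, Finset.sum_eq_single i]
  · simp_rw [real_inner_self_eq_norm_sq]
  · exact fun j _ hj => hcross i j hj.symm
  · exact fun h => absurd hi h

theorem measure_le_ofReal_of_integral_norm_sq {Ω : Type*} [MeasurableSpace Ω] {P : Measure Ω}
    [IsFiniteMeasure P] {E : Type*} [NormedAddCommGroup E] {F : Ω → E}
    (hF : Integrable (fun ω => ‖F ω‖ ^ 2) P) {C η : ℝ} (hη : 0 < η)
    (hC : ∫ ω, ‖F ω‖ ^ 2 ∂P ≤ C) :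
    P {ω | η ≤ ‖F ω‖} ≤ ENNReal.ofReal (C / η ^ 2) := by
  have h1 : {ω | η ≤ ‖F ω‖} ⊆ {ω | η ^ 2 ≤ ‖F ω‖ ^ 2} := fun ω (hω : η ≤ ‖F ω‖) => by
    change η ^ 2 ≤ ‖F ω‖ ^ 2; gcongr
  have h2 := mul_meas_ge_le_integral_of_nonneg (μ := P) (f := fun ω => ‖F ω‖ ^ 2)
    (Eventually.of_forall fun ω => sq_nonneg _) hF (η ^ 2)
  refine (measure_mono h1).trans ?_
  rw [← ofReal_measureReal]
  refine ENNReal.ofReal_le_ofReal ?_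
  rw [le_div_iff₀ (by positivity), mul_comm]
  exact h2.trans hC

end ProductMeasure

section Noise

variable {X : Type*} [MeasurableSpace X] {ρ : Measure X} [IsProbabilityMeasure ρ]
  {ν : Kernel X ℝ} [IsMarkovKernel ν]

theorem integral_compProd_mul_eq_zero {q : X × ℝ → ℝ}
    (hq : ∀ᵐ x ∂ρ, ∫ y, q (x, y) ∂(ν x) = 0) (h : X → ℝ) :
    ∫ w, q w * h w.1 ∂(ρ ⊗ₘ ν) = 0 := by
  by_cases hint : Integrable (fun w : X × ℝ => q w * h w.1) (ρ ⊗ₘ ν)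
  · rw [Measure.integral_compProd hint]
    refine integral_eq_zero_of_ae ?_
    filter_upwards [hq] with x hx
    simp only [integral_mul_const, hx, zero_mul, Pi.zero_apply]
  · exact integral_undef hint

theorem integral_compProd_mul_nonpos {q : X × ℝ → ℝ}
    (hq : ∀ᵐ x ∂ρ, ∫ y, q (x, y) ∂(ν x) ≤ 0) {h : X → ℝ} (hh : ∀ x, 0 ≤ h x) :
    ∫ w, q w * h w.1 ∂(ρ ⊗ₘ ν) ≤ 0 := by
  by_cases hint : Integrable (fun w : X × ℝ => q w * h w.1) (ρ ⊗ₘ ν)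
  · rw [Measure.integral_compProd hint]
    refine integral_nonpos_of_ae ?_
    filter_upwards [hq] with x hx
    simp only [integral_mul_const, Pi.zero_apply]
    exact mul_nonpos_of_nonpos_of_nonneg hx (hh x)
  · exact (integral_undef hint).le

/-- If the residual `e` of a sample point has conditional mean zero given the design, then residuals
at different sample points are uncorrelated, also with weights that depend on the whole design. -/
theorem integral_pi_residual_mul_eq_zero {n : ℕ} {e : X × ℝ → ℝ}
    (he : ∀ᵐ x ∂ρ, ∫ y, e (x, y) ∂(ν x) = 0) (W : (Fin n → X) → ℝ) {i j : Fin n} (hij : i ≠ j)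
    (hint : Integrable (fun z => e (z i) * e (z j) * W fun l => (z l).1)
      (Measure.pi fun _ => ρ ⊗ₘ ν)) :
    ∫ z, e (z i) * e (z j) * W (fun l => (z l).1) ∂(Measure.pi fun _ => ρ ⊗ₘ ν) = 0 := by
  cases n with
  | zero => exact i.elim0
  | succ n =>
    obtain ⟨j, rfl⟩ := Fin.exists_succAbove_eq hij.symm
    rw [integral_pi_eq_integral_insertNth i hint]
    refine integral_eq_zero_of_ae (Eventually.of_forall fun z' => ?_)
    have h := integral_compProd_mul_eq_zero (ρ := ρ) (ν := ν) he fun x =>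
      e (z' j) * W (i.insertNth x fun l => (z' l).1)
    refine Eq.trans (integral_congr_ae (Eventually.of_forall fun w => ?_)) h
    have h2 : (fun l => ((i.insertNth w z' : Fin (n + 1) → X × ℝ) l).1) =
        i.insertNth w.1 fun l => (z' l).1 := by
      funext l
      refine i.succAboveCases ?_ (fun l => ?_) l <;> simp
    simp only [Fin.insertNth_apply_same, Fin.insertNth_apply_succAbove, h2]
    ring

/-- A conditional second moment bound for the residuals, with weights that depend on the whole
design. -/
theorem integral_pi_residual_sq_mul_le {n : ℕ} {e : X × ℝ → ℝ} {σ : ℝ}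
    (he : ∀ᵐ x ∂ρ, ∫ y, (e (x, y) ^ 2 - σ) ∂(ν x) ≤ 0) {W : (Fin n → X) → ℝ} (hW : ∀ x, 0 ≤ W x)
    {i : Fin n}
    (hint : Integrable (fun z => e (z i) ^ 2 * W fun l => (z l).1) (Measure.pi fun _ => ρ ⊗ₘ ν))
    (hintW : Integrable (fun z : Fin n → X × ℝ => W fun l => (z l).1)
      (Measure.pi fun _ => ρ ⊗ₘ ν)) :
    ∫ z, e (z i) ^ 2 * W (fun l => (z l).1) ∂(Measure.pi fun _ => ρ ⊗ₘ ν) ≤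
      σ * ∫ z : Fin n → X × ℝ, W (fun l => (z l).1) ∂(Measure.pi fun _ => ρ ⊗ₘ ν) := by
  cases n with
  | zero => exact i.elim0
  | succ n =>
    rw [← integral_const_mul, ← sub_nonpos, ← integral_sub hint (hintW.const_mul σ)]
    have hint' := hint.sub (hintW.const_mul σ)
    refine (integral_pi_eq_integral_insertNth i hint').trans_le ?_
    refine integral_nonpos fun z' => ?_
    have h := integral_compProd_mul_nonpos (ρ := ρ) (ν := ν)
      (q := fun w => e w ^ 2 - σ) he
      (h := fun x => W (i.insertNth x fun l => (z' l).1)) fun x => hW _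
    refine le_trans (integral_congr_ae (Eventually.of_forall fun w => ?_)).le h
    have h2 : (fun l => ((i.insertNth w z' : Fin (n + 1) → X × ℝ) l).1) =
        i.insertNth w.1 fun l => (z' l).1 := by
      funext l
      refine i.succAboveCases ?_ (fun l => ?_) l <;> simp
    simp only [Pi.sub_apply, Fin.insertNth_apply_same, h2]
    ring

/-- The exponential moment condition bounds the conditional variance: `e^u - u - 1 ≥ u² / 2`. -/
theorem lintegral_sq_le_of_exp_moment {P : Measure ℝ} {a B γ : ℝ} (hB : 0 < B)
    (h : ∫⁻ y, ENNReal.ofReal (Real.exp (|y - a| / B) - |y - a| / B - 1) ∂P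
      ≤ ENNReal.ofReal (γ ^ 2 / (2 * B ^ 2))) :
    ∫⁻ y, ENNReal.ofReal ((y - a) ^ 2) ∂P ≤ ENNReal.ofReal (γ ^ 2) := by
  have h1 : ∀ y : ℝ, ENNReal.ofReal ((y - a) ^ 2) ≤ ENNReal.ofReal (2 * B ^ 2) *
      ENNReal.ofReal (Real.exp (|y - a| / B) - |y - a| / B - 1) := by
    intro y
    rw [← ENNReal.ofReal_mul (by positivity)]
    refine ENNReal.ofReal_le_ofReal ?_
    have h2 := Real.quadratic_le_exp_of_nonneg (show 0 ≤ |y - a| / B by positivity)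
    have h3 : (y - a) ^ 2 = 2 * B ^ 2 * ((|y - a| / B) ^ 2 / 2) := by
      rw [div_pow, sq_abs]; field_simp
    rw [h3]
    gcongr
    linarith
  calc ∫⁻ y, ENNReal.ofReal ((y - a) ^ 2) ∂P
      ≤ ∫⁻ y, ENNReal.ofReal (2 * B ^ 2) *
          ENNReal.ofReal (Real.exp (|y - a| / B) - |y - a| / B - 1) ∂P := lintegral_mono h1
    _ = ENNReal.ofReal (2 * B ^ 2) *
          ∫⁻ y, ENNReal.ofReal (Real.exp (|y - a| / B) - |y - a| / B - 1) ∂P :=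
        lintegral_const_mul' _ _ ENNReal.ofReal_ne_top
    _ ≤ ENNReal.ofReal (2 * B ^ 2) * ENNReal.ofReal (γ ^ 2 / (2 * B ^ 2)) := by gcongr
    _ = ENNReal.ofReal (γ ^ 2) := by
        rw [← ENNReal.ofReal_mul (by positivity)]
        congr 1; field_simp

end Noise

section TailBound

variable {X : Type*} {H : Type*} [NormedAddCommGroup H] [InnerProductSpace ℝ H]
  [CompleteSpace H] [RKHS ℝ H X ℝ] [MeasurableSpace X] {ρ : Measure X} [IsProbabilityMeasure ρ]
  {κ : ℝ} {ν : Kernel X ℝ} [IsMarkovKernel ν]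

/-- The properties of the residual `y - f(x)` that consistency depends on: it is square integrable,
and given `x` it has mean zero and second moment at most `σ`. -/
structure CenteredResidual (ρ : Measure X) (ν : Kernel X ℝ) (f : H) (σ : ℝ) : Prop where
  memLp : MemLp (fun w : X × ℝ => w.2 - f w.1) 2 (ρ ⊗ₘ ν)
  integral_eq_zero : ∀ᵐ x ∂ρ, ∫ y, (y - f x) ∂(ν x) = 0
  integral_sq_sub_nonpos : ∀ᵐ x ∂ρ, ∫ y, ((y - f x) ^ 2 - σ) ∂(ν x) ≤ 0

theorem centeredResidual (hK : BoundedKernel H ρ κ) {f : H}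
    (hf : ∀ᵐ x ∂ρ, f x = ∫ y, y ∂(ν x))
    (hsq : Integrable (fun z : X × ℝ => z.2 ^ 2) (ρ ⊗ₘ ν)) {B γ : ℝ} (hB : 0 < B)
    (hnoise : ∀ᵐ x ∂ρ,
      ∫⁻ y, ENNReal.ofReal (Real.exp (|y - f x| / B) - |y - f x| / B - 1) ∂(ν x)
        ≤ ENNReal.ofReal (γ ^ 2 / (2 * B ^ 2))) :
    CenteredResidual ρ ν f (γ ^ 2) := by
  have hfst : MeasurePreserving (Prod.fst : X × ℝ → X) (ρ ⊗ₘ ν) ρ :=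
    ⟨measurable_fst, Measure.fst_compProd ρ ν⟩
  have hy : MemLp (fun w : X × ℝ => w.2) 2 (ρ ⊗ₘ ν) :=
    (memLp_two_iff_integrable_sq measurable_snd.aestronglyMeasurable).2 hsq
  have hmem : MemLp (fun w : X × ℝ => w.2 - f w.1) 2 (ρ ⊗ₘ ν) :=
    hy.sub ((hK.memLp f).comp_measurePreserving hfst)
  have hy1 : ∀ᵐ x ∂ρ, Integrable (fun y : ℝ => y) (ν x) :=
    (hy.integrable one_le_two).ae_of_compProd
  have hy2 : ∀ᵐ x ∂ρ, Integrable (fun y : ℝ => (y - f x) ^ 2) (ν x) :=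
    hmem.integrable_sq.ae_of_compProd
  refine ⟨hmem, ?_, ?_⟩
  · filter_upwards [hf, hy1] with x hx hx1
    rw [integral_sub hx1 (integrable_const _), ← hx]
    simp
  · filter_upwards [hnoise, hy2] with x hx hx2
    rw [integral_sub hx2 (integrable_const _)]
    have h := lintegral_sq_le_of_exp_moment hB hx
    rw [← ofReal_integral_eq_lintegral_ofReal hx2 (Eventually.of_forall fun y => sq_nonneg _),
      ENNReal.ofReal_le_ofReal_iff (sq_nonneg _)] at h
    simpa using h

variable (H) in
/-- The feature vectors `K_{x_i}` of a sample. -/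
def features {n : ℕ} (z : Fin n → X × ℝ) : Fin n → H := fun i => kernelSection H (z i).1

theorem aestronglyMeasurable_features (hK : BoundedKernel H ρ κ) (n : ℕ) :
    AEStronglyMeasurable (fun z : Fin n → X × ℝ => features H z)
      (Measure.pi fun _ => ρ ⊗ₘ ν) := by
  have hfst : MeasurePreserving (Prod.fst : X × ℝ → X) (ρ ⊗ₘ ν) ρ :=
    ⟨measurable_fst, Measure.fst_compProd ρ ν⟩
  exact aestronglyMeasurable_pi fun i => hK.aestronglyMeasurable.comp_measurePreserving
    (hfst.comp (measurePreserving_eval (fun _ : Fin n => ρ ⊗ₘ ν) i))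

theorem integral_pi_fst_eval {n : ℕ} (i : Fin n) {h : X → ℝ} (hh : Integrable h ρ) :
    Integrable (fun z : Fin n → X × ℝ => h (z i).1) (Measure.pi fun _ => ρ ⊗ₘ ν) ∧
    ∫ z : Fin n → X × ℝ, h (z i).1 ∂(Measure.pi fun _ => ρ ⊗ₘ ν) = ∫ x, h x ∂ρ := by
  have hfst : MeasurePreserving (Prod.fst : X × ℝ → X) (ρ ⊗ₘ ν) ρ :=
    ⟨measurable_fst, Measure.fst_compProd ρ ν⟩
  have hmp := hfst.comp (measurePreserving_eval (fun _ : Fin n => ρ ⊗ₘ ν) i)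
  refine ⟨hmp.integrable_comp_of_integrable hh, ?_⟩
  have h1 := integral_map (μ := Measure.pi fun _ : Fin n => ρ ⊗ₘ ν) hmp.measurable.aemeasurable
    (f := h) (by rw [hmp.map_eq]; exact hh.aestronglyMeasurable)
  rw [hmp.map_eq] at h1
  exact h1.symm

/-- The law of large numbers in mean square for the sample covariance operator. -/
theorem integral_norm_sq_sampleCov_sub_le (hK : BoundedKernel H ρ κ) {n : ℕ} {s : Finset (Fin n)}
    (hs : s.Nonempty) (g : H) :
    Integrable (fun z => ‖sampleCov s (features H z) g - covOp hK g‖ ^ 2)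
      (Measure.pi fun _ => ρ ⊗ₘ ν) ∧
    ∫ z, ‖sampleCov s (features H z) g - covOp hK g‖ ^ 2 ∂(Measure.pi fun _ => ρ ⊗ₘ ν) ≤
      (2 * κ ^ 2 * ‖g‖) ^ 2 / s.card := by
  set D : X → H := fun x => ⟪kernelSection H x, g⟫_ℝ • kernelSection H x - covOp hK g with hD
  have hκ := hK.nonneg
  have hcard : (0 : ℝ) < s.card := by exact_mod_cast hs.card_pos
  have hb1 : ∀ x, ‖⟪kernelSection H x, g⟫_ℝ • kernelSection H x‖ ≤ κ ^ 2 * ‖g‖ := by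
    intro x
    have h := hK.norm_kernelSection_le x
    rw [norm_smul]
    calc ‖⟪kernelSection H x, g⟫_ℝ‖ * ‖kernelSection H x‖
        ≤ (‖kernelSection H x‖ * ‖g‖) * ‖kernelSection H x‖ := by
          gcongr; exact norm_inner_le_norm _ _
      _ ≤ (κ * ‖g‖) * κ := by gcongr
      _ = κ ^ 2 * ‖g‖ := by ring
  have hmeas : AEStronglyMeasurable (fun x => ⟪kernelSection H x, g⟫_ℝ • kernelSection H x) ρ :=
    (hK.aestronglyMeasurable.inner aestronglyMeasurable_const).smul hK.aestronglyMeasurable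
  have hint1 : Integrable (fun x => ⟪kernelSection H x, g⟫_ℝ • kernelSection H x) ρ :=
    Integrable.of_bound hmeas _ (Eventually.of_forall hb1)
  have hb2 : ‖covOp hK g‖ ≤ κ ^ 2 * ‖g‖ := by
    rw [covOp_apply]
    simpa using norm_integral_le_of_norm_le_const (Eventually.of_forall hb1) (μ := ρ)
  have hbD : ∀ x, ‖D x‖ ≤ 2 * κ ^ 2 * ‖g‖ := fun x =>
    (norm_sub_le _ _).trans (by linarith [hb1 x])
  have hDmeas : AEStronglyMeasurable D ρ := hmeas.sub aestronglyMeasurable_const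
  have hDint : Integrable D ρ := hint1.sub (integrable_const _)
  have hD0 : ∫ x, D x ∂ρ = 0 := by
    rw [hD, integral_sub hint1 (integrable_const _), ← covOp_apply hK]
    simp
  have hfst : MeasurePreserving (Prod.fst : X × ℝ → X) (ρ ⊗ₘ ν) ρ :=
    ⟨measurable_fst, Measure.fst_compProd ρ ν⟩
  have hDz : ∀ i, AEStronglyMeasurable (fun z : Fin n → X × ℝ => D (z i).1)
      (Measure.pi fun _ => ρ ⊗ₘ ν) := fun i =>
    hDmeas.comp_measurePreserving
      (hfst.comp (measurePreserving_eval (fun _ : Fin n => ρ ⊗ₘ ν) i))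
  have hint : ∀ i j, Integrable (fun z : Fin n → X × ℝ => ⟪D (z i).1, D (z j).1⟫_ℝ)
      (Measure.pi fun _ => ρ ⊗ₘ ν) := fun i j =>
    Integrable.of_bound ((hDz i).inner (hDz j)) ((2 * κ ^ 2 * ‖g‖) * (2 * κ ^ 2 * ‖g‖))
      (Eventually.of_forall fun z => (norm_inner_le_norm _ _).trans (by
        gcongr
        · exact hbD _
        · exact hbD _))
  have hcross : ∀ i j, i ≠ j → ∫ z : Fin n → X × ℝ, ⟪D (z i).1, D (z j).1⟫_ℝ
      ∂(Measure.pi fun _ => ρ ⊗ₘ ν) = 0 := by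
    intro i j hij
    cases n with
    | zero => exact i.elim0
    | succ n =>
      obtain ⟨j, rfl⟩ := Fin.exists_succAbove_eq hij.symm
      rw [integral_pi_eq_integral_insertNth i (hint _ _)]
      refine integral_eq_zero_of_ae (Eventually.of_forall fun z' => ?_)
      simp only [Fin.insertNth_apply_same, Fin.insertNth_apply_succAbove, Pi.zero_apply]
      have h1 : ∫ w : X × ℝ, ⟪D (z' j).1, D w.1⟫_ℝ ∂(ρ ⊗ₘ ν) = ⟪D (z' j).1, ∫ x, D x ∂ρ⟫_ℝ := by
        rw [← integral_inner hDint]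
        have h2 := integral_map (μ := ρ ⊗ₘ ν) hfst.measurable.aemeasurable
          (f := fun x => ⟪D (z' j).1, D x⟫_ℝ)
          (by rw [hfst.map_eq]; exact aestronglyMeasurable_const.inner hDmeas)
        rw [hfst.map_eq] at h2
        exact h2.symm
      simp_rw [real_inner_comm (D (z' j).1)]
      rw [h1, hD0, inner_zero_right]
  have hrepr : ∀ z : Fin n → X × ℝ, sampleCov s (features H z) g - covOp hK g =
      (s.card : ℝ)⁻¹ • ∑ i ∈ s, D (z i).1 := by
    intro z
    rw [hD, Finset.sum_sub_distrib, Finset.sum_const, smul_sub, ← Nat.cast_smul_eq_nsmul ℝ, smul_smul,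
      inv_mul_cancel₀ hcard.ne', one_smul, sampleCov_apply]
    rfl
  obtain ⟨h1, h2⟩ := integral_norm_sq_average (s := s) hint hcross
  simp_rw [hrepr]
  refine ⟨h1, h2.trans_le ?_⟩
  have h3 : ∀ i ∈ s, ∫ z : Fin n → X × ℝ, ‖D (z i).1‖ ^ 2 ∂(Measure.pi fun _ => ρ ⊗ₘ ν) ≤
      (2 * κ ^ 2 * ‖g‖) ^ 2 := by
    intro i _
    have h4 : Integrable (fun z : Fin n → X × ℝ => ‖D (z i).1‖ ^ 2)
        (Measure.pi fun _ => ρ ⊗ₘ ν) := by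
      simpa only [real_inner_self_eq_norm_sq] using hint i i
    refine (integral_mono h4 (integrable_const ((2 * κ ^ 2 * ‖g‖) ^ 2)) fun z => ?_).trans (by simp)
    have := hbD (z i).1
    dsimp only
    gcongr
  calc (s.card : ℝ)⁻¹ ^ 2 *
        ∑ i ∈ s, ∫ z : Fin n → X × ℝ, ‖D (z i).1‖ ^ 2 ∂(Measure.pi fun _ => ρ ⊗ₘ ν)
      ≤ (s.card : ℝ)⁻¹ ^ 2 * (s.card * (2 * κ ^ 2 * ‖g‖) ^ 2) := by
        gcongr
        simpa using Finset.sum_le_sum h3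
    _ = (2 * κ ^ 2 * ‖g‖) ^ 2 / s.card := by field_simp

end TailBound

/-! ### Consistency of kernel ridge regression in the norm of the Hilbert space -/

section Consistency

variable {X : Type*} {H : Type*} [NormedAddCommGroup H] [InnerProductSpace ℝ H]
  [CompleteSpace H] [RKHS ℝ H X ℝ] [MeasurableSpace X] {ρ : Measure X} [IsProbabilityMeasure ρ]
  {κ : ℝ} {ν : Kernel X ℝ} [IsMarkovKernel ν]

/-- The regularized feature vectors `(A + t)⁻¹ v_i`, where `A` is the sample covariance of the `v_i`. -/
def regFeature {n : ℕ} (s : Finset (Fin n)) (t : ℝ) (v : Fin n → H) (i : Fin n) : H :=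
  regInv (sampleCov s v) t (v i)

section RegFeature

variable {n : ℕ} {s : Finset (Fin n)} {t : ℝ}

theorem aestronglyMeasurable_regFeature (hK : BoundedKernel H ρ κ) (ht : 0 < t) (i : Fin n) :
    AEStronglyMeasurable (fun z => regFeature s t (features H z) i)
      (Measure.pi fun _ => ρ ⊗ₘ ν) := by
  have h : Continuous fun v : Fin n → H => regFeature s t v i :=
    (continuous_regInv (continuous_sampleCov s) (isPositive_sampleCov s) ht).clm_apply
      (continuous_apply i)
  exact h.comp_aestronglyMeasurable (aestronglyMeasurable_features hK n)

omit [IsProbabilityMeasure ρ] in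
theorem norm_regFeature_le (hK : BoundedKernel H ρ κ) (ht : 0 < t) (z : Fin n → X × ℝ)
    (i : Fin n) : ‖regFeature s t (features H z) i‖ ≤ κ / t := by
  rw [le_div_iff₀ ht, mul_comm]
  exact (mul_norm_regInv_le (isPositive_sampleCov s _) ht _).trans (hK.norm_kernelSection_le _)

theorem integrable_norm_sq_regFeature (hK : BoundedKernel H ρ κ) (ht : 0 < t) (i : Fin n) :
    Integrable (fun z => ‖regFeature s t (features H z) i‖ ^ 2)
      (Measure.pi fun _ => ρ ⊗ₘ ν) := by
  refine Integrable.of_bound ((aestronglyMeasurable_regFeature hK ht i).norm.pow 2) ((κ / t) ^ 2)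
    (Eventually.of_forall fun z => ?_)
  rw [Real.norm_of_nonneg (by positivity)]
  have := norm_regFeature_le (s := s) hK ht z i
  gcongr

/-- The expected empirical effective dimension is of the order `t ^ (-α)`. -/
theorem sum_integral_norm_sq_regFeature_le (hK : BoundedKernel H ρ κ) {α Q : ℝ} (hα : 0 < α)
    (hQ : 0 ≤ Q)
    (hdim : ∀ t : ℝ, 0 < t → effectiveDim hK t ≤ ENNReal.ofReal (Q * t ^ (-α)))
    (hs : s.Nonempty) (ht : 0 < t) :
    t * ((s.card : ℝ)⁻¹ * ∑ i ∈ s,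
        ∫ z, ‖regFeature s t (features H z) i‖ ^ 2 ∂(Measure.pi fun _ => ρ ⊗ₘ ν)) ≤
      Q / (1 - 2 ^ (-α)) * t ^ (-α) + Q * t ^ (-α) := by
  have hcard : (0 : ℝ) < s.card := by exact_mod_cast hs.card_pos
  set R := regInv (covOp hK) t with hR
  generalize hC : Q / (1 - 2 ^ (-α)) * t ^ (-α) = C
  have hpath : ∀ z : Fin n → X × ℝ,
      t * ((s.card : ℝ)⁻¹ * ∑ i ∈ s, ‖regFeature s t (features H z) i‖ ^ 2) ≤
      C + t * ((s.card : ℝ)⁻¹ * ∑ i ∈ s, ‖R (kernelSection H (z i).1)‖ ^ 2) := by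
    intro z
    refine le_trans ?_ (sampleMean_inner_regInv_le (isPositive_covOp hK) ht
      (fun k b hb => (sum_inner_covOp_regInv_le hK hα hQ hdim ht hb).trans hC.le) (s := s)
      (features H z))
    rw [mul_left_comm, Finset.mul_sum]
    exact mul_le_mul_of_nonneg_left
      (Finset.sum_le_sum fun i _ => mul_norm_sq_regInv_le (isPositive_sampleCov s _) ht _)
      (inv_nonneg.2 hcard.le)
  have hu := fun i => integrable_norm_sq_regFeature (ν := ν) (s := s) hK ht i
  have hRint := fun i => integral_pi_fst_eval (ν := ν) (n := n) i
    (integrable_norm_sq_kernelSection hK R)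
  have hint : Integrable (fun z : Fin n → X × ℝ =>
      t * ((s.card : ℝ)⁻¹ * ∑ i ∈ s, ‖R (kernelSection H (z i).1)‖ ^ 2))
      (Measure.pi fun _ => ρ ⊗ₘ ν) :=
    ((integrable_finsetSum _ fun i _ => (hRint i).1).const_mul _).const_mul _
  have hmean : ∫ z : Fin n → X × ℝ,
      t * ((s.card : ℝ)⁻¹ * ∑ i ∈ s, ‖R (kernelSection H (z i).1)‖ ^ 2)
        ∂(Measure.pi fun _ => ρ ⊗ₘ ν) = t * ∫ x, ‖R (kernelSection H x)‖ ^ 2 ∂ρ := by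
    rw [integral_const_mul, integral_const_mul, integral_finsetSum _ fun i _ => (hRint i).1,
      Finset.sum_congr rfl fun i _ => (hRint i).2, Finset.sum_const, nsmul_eq_mul,
      inv_mul_cancel_left₀ hcard.ne']
  rw [← integral_finsetSum _ fun i _ => hu i, ← integral_const_mul, ← integral_const_mul]
  refine (integral_mono (((integrable_finsetSum _ fun i _ => hu i).const_mul _).const_mul _)
    ((integrable_const C).add hint) hpath).trans ?_
  rw [integral_add' (integrable_const _) hint, hmean]
  have h := mul_integral_norm_sq_regInv_le hK ht (by positivity) (hdim t ht)
  simpa using h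

end RegFeature

/-- The variance of kernel ridge regression, bounded by the effective dimension: averaging over the
residuals first leaves the empirical effective dimension, which is averaged over the design. -/
theorem integral_norm_sq_regInv_noise_le (hK : BoundedKernel H ρ κ) {f : H} {σ : ℝ} (hσ : 0 ≤ σ)
    (he : CenteredResidual ρ ν f σ) {α Q : ℝ} (hα : 0 < α) (hQ : 0 ≤ Q)
    (hdim : ∀ t : ℝ, 0 < t → effectiveDim hK t ≤ ENNReal.ofReal (Q * t ^ (-α)))
    {n : ℕ} {s : Finset (Fin n)} (hs : s.Nonempty) {t : ℝ} (ht : 0 < t) :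
    Integrable (fun z => ‖regInv (sampleCov s (features H z)) t
        ((s.card : ℝ)⁻¹ • ∑ i ∈ s, ((z i).2 - f (z i).1) • features H z i)‖ ^ 2)
      (Measure.pi fun _ => ρ ⊗ₘ ν) ∧
    ∫ z, ‖regInv (sampleCov s (features H z)) t
        ((s.card : ℝ)⁻¹ • ∑ i ∈ s, ((z i).2 - f (z i).1) • features H z i)‖ ^ 2
          ∂(Measure.pi fun _ => ρ ⊗ₘ ν) ≤
      σ * (Q / (1 - 2 ^ (-α)) + Q) * t ^ (-1 - α) / s.card := by
  have hcard : (0 : ℝ) < s.card := by exact_mod_cast hs.card_pos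
  have hκ := hK.nonneg
  have hκt : 0 ≤ κ / t := by positivity
  let e : X × ℝ → ℝ := fun w => w.2 - f w.1
  have hemem : ∀ i, MemLp (fun z : Fin n → X × ℝ => e (z i)) 2 (Measure.pi fun _ => ρ ⊗ₘ ν) :=
    fun i => he.memLp.comp_measurePreserving (measurePreserving_eval (fun _ : Fin n => ρ ⊗ₘ ν) i)
  have hinner : ∀ i j, Integrable (fun z => e (z i) * e (z j) *
      ⟪regFeature s t (features H z) i, regFeature s t (features H z) j⟫_ℝ)
      (Measure.pi fun _ => ρ ⊗ₘ ν) := by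
    intro i j
    refine ((hemem i).integrable_mul (hemem j)).mul_bdd (c := κ / t * (κ / t))
      ((aestronglyMeasurable_regFeature hK ht i).inner (aestronglyMeasurable_regFeature hK ht j))
      (Eventually.of_forall fun z => ?_)
    exact (norm_inner_le_norm _ _).trans (mul_le_mul (norm_regFeature_le hK ht z i)
      (norm_regFeature_le hK ht z j) (norm_nonneg _) hκt)
  have hξ : ∀ i j z, ⟪e (z i) • regFeature s t (features H z) i,
      e (z j) • regFeature s t (features H z) j⟫_ℝ = e (z i) * e (z j) *
      ⟪regFeature s t (features H z) i, regFeature s t (features H z) j⟫_ℝ := by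
    intro i j z
    rw [real_inner_smul_left, real_inner_smul_right, mul_assoc]
  have hcross : ∀ i j, i ≠ j → ∫ z, ⟪e (z i) • regFeature s t (features H z) i,
      e (z j) • regFeature s t (features H z) j⟫_ℝ ∂(Measure.pi fun _ => ρ ⊗ₘ ν) = 0 := by
    intro i j hij
    simp_rw [hξ]
    exact integral_pi_residual_mul_eq_zero he.integral_eq_zero
      (fun x => ⟪regFeature s t (fun l => kernelSection H (x l)) i,
        regFeature s t (fun l => kernelSection H (x l)) j⟫_ℝ) hij (hinner i j)
  obtain ⟨h1, h2⟩ := integral_norm_sq_average (s := s) (P := Measure.pi fun _ => ρ ⊗ₘ ν)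
    (ξ := fun i z => e (z i) • regFeature s t (features H z) i)
    (fun i j => by simp_rw [hξ]; exact hinner i j) hcross
  have hrepr : ∀ z : Fin n → X × ℝ, regInv (sampleCov s (features H z)) t
      ((s.card : ℝ)⁻¹ • ∑ i ∈ s, ((z i).2 - f (z i).1) • features H z i) =
      (s.card : ℝ)⁻¹ • ∑ i ∈ s, e (z i) • regFeature s t (features H z) i := by
    intro z
    simp only [map_smul, map_sum, e, regFeature]
  simp_rw [hrepr]
  refine ⟨h1, h2.trans_le ?_⟩
  have hdiag : ∀ i ∈ s, ∫ z, ‖e (z i) • regFeature s t (features H z) i‖ ^ 2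
      ∂(Measure.pi fun _ => ρ ⊗ₘ ν) ≤
      σ * ∫ z, ‖regFeature s t (features H z) i‖ ^ 2 ∂(Measure.pi fun _ => ρ ⊗ₘ ν) := by
    intro i _
    have h3 : ∀ z, ‖e (z i) • regFeature s t (features H z) i‖ ^ 2 =
        e (z i) ^ 2 * ‖regFeature s t (features H z) i‖ ^ 2 := fun z => by
      rw [norm_smul, mul_pow, Real.norm_eq_abs, sq_abs]
    simp_rw [h3]
    have h4 := hinner i i
    simp only [real_inner_self_eq_norm_sq, ← sq] at h4
    exact integral_pi_residual_sq_mul_le (e := e)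
      (W := fun x => ‖regFeature s t (fun l => kernelSection H (x l)) i‖ ^ 2)
      he.integral_sq_sub_nonpos (fun x => sq_nonneg _) h4 (integrable_norm_sq_regFeature hK ht i)
  have hmean := sum_integral_norm_sq_regFeature_le (ν := ν) hK hα hQ hdim hs ht
  have hrpow : t ^ (-1 - α) = t ^ (-α) / t := by
    rw [show (-1 - α) = -α - 1 by ring, Real.rpow_sub_one ht.ne']
  refine (mul_le_mul_of_nonneg_left (Finset.sum_le_sum hdiag) (by positivity)).trans ?_
  rw [← Finset.mul_sum]
  generalize (∑ i ∈ s, ∫ z, ‖regFeature s t (features H z) i‖ ^ 2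
    ∂(Measure.pi fun _ => ρ ⊗ₘ ν)) = S at hmean
  calc (s.card : ℝ)⁻¹ ^ 2 * (σ * S) = σ / (s.card * t) * (t * ((s.card : ℝ)⁻¹ * S)) := by
        field_simp
    _ ≤ σ / (s.card * t) * (Q / (1 - 2 ^ (-α)) * t ^ (-α) + Q * t ^ (-α)) :=
        mul_le_mul_of_nonneg_left hmean (by positivity)
    _ = σ * (Q / (1 - 2 ^ (-α)) + Q) * t ^ (-1 - α) / s.card := by
        rw [hrpow, ← add_mul]
        generalize Q / (1 - 2 ^ (-α)) + Q = q
        field_simp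

/-- A nonasymptotic error bound in probability. The vector `g` is a smooth approximate preimage of the
regression function under the covariance operator. -/
theorem measure_krr_error_le (hK : BoundedKernel H ρ κ) {f : H} {σ : ℝ} (hσ : 0 ≤ σ)
    (he : CenteredResidual ρ ν f σ) {α Q : ℝ} (hα : 0 < α) (hQ : 0 ≤ Q)
    (hdim : ∀ t : ℝ, 0 < t → effectiveDim hK t ≤ ENNReal.ofReal (Q * t ^ (-α)))
    {n : ℕ} {s : Finset (Fin n)} (hs : s.Nonempty) {t : ℝ} (ht : 0 < t) {η : ℝ} (hη : 0 < η)
    {g : H} (hg : ‖f - covOp hK g‖ ≤ η / 8) (htg : t * ‖g‖ ≤ η / 8) :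
    (Measure.pi fun _ => ρ ⊗ₘ ν) {z : Fin n → X × ℝ | η ≤ ‖krr H s z t - f‖} ≤
      ENNReal.ofReal (σ * (Q / (1 - 2 ^ (-α)) + Q) * t ^ (-1 - α) / s.card / (η / 2) ^ 2) +
      ENNReal.ofReal ((2 * κ ^ 2 * ‖g‖) ^ 2 / s.card / (η / 4) ^ 2) := by
  obtain ⟨h1, h2⟩ := integral_norm_sq_regInv_noise_le (ν := ν) hK hσ he hα hQ hdim hs ht
  obtain ⟨h3, h4⟩ := integral_norm_sq_sampleCov_sub_le (ν := ν) hK hs g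
  refine le_trans ((measure_mono fun z hz => ?_).trans (measure_union_le _ _))
    (add_le_add (measure_le_ofReal_of_integral_norm_sq h1 (half_pos hη) h2)
      (measure_le_ofReal_of_integral_norm_sq h3 (by positivity : 0 < η / 4) h4))
  by_contra hcon
  simp only [Set.mem_union, Set.mem_ofPred_eq, not_or, not_le] at hcon hz
  have h5 := norm_smul_regInv_le (isPositive_sampleCov s (features H z)) (covOp hK) ht f g
  have h6 := krr_sub_eq s z ht f
  rw [h6] at hz
  have h7 := norm_sub_le (regInv (sampleCov s (features H z)) t
    ((s.card : ℝ)⁻¹ • ∑ i ∈ s, ((z i).2 - f (z i).1) • features H z i))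
    (t • regInv (sampleCov s (features H z)) t f)
  have h8 := hz.trans h7
  linarith [hcon.1, hcon.2]

/-- Consistency of kernel ridge regression in the norm of `H_K`, uniformly over the subsamples that
contain a fixed proportion of the data. -/
theorem krr_consistent (hK : BoundedKernel H ρ κ) {f : H} {σ : ℝ} (hσ : 0 ≤ σ)
    (he : CenteredResidual ρ ν f σ) {α Q : ℝ} (hα : 0 < α) (hQ : 0 ≤ Q)
    (hdim : ∀ t : ℝ, 0 < t → effectiveDim hK t ≤ ENNReal.ofReal (Q * t ^ (-α)))
    (hf : f ∈ (LinearMap.range (covOp hK).toLinearMap).topologicalClosure)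
    {r : ℝ} (hr : 1 / 2 < r) {c c₁ c₂ : ℝ} (hc : 0 < c) (hc₁ : 0 < c₁)
    {η : ℝ} (hη : 0 < η) {ε : ℝ≥0∞} (hε : 0 < ε) :
    ∀ᶠ n : ℕ in atTop, ∀ s : Finset (Fin n), c * n ≤ s.card → ∀ t : ℝ,
      c₁ * (n : ℝ) ^ (-1 / (2 * r + α)) ≤ t → t ≤ c₂ * (n : ℝ) ^ (-1 / (2 * r + α)) →
      (Measure.pi fun _ => ρ ⊗ₘ ν) {z : Fin n → X × ℝ | η ≤ ‖krr H s z t - f‖} ≤ ε := by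
  obtain ⟨-, ⟨g, rfl⟩, hg⟩ := Metric.mem_closure_iff.1 hf (η / 8) (by positivity)
  rw [dist_eq_norm] at hg
  have hra : 0 < 2 * r + α := by linarith
  set β := 1 / (2 * r + α) with hβ
  have hβ0 : 0 < β := by positivity
  have hβ' : -1 / (2 * r + α) = -β := by rw [hβ]; ring
  set D := σ * (Q / (1 - 2 ^ (-α)) + Q) with hD
  have hq1 : (2 : ℝ) ^ (-α) < 1 := Real.rpow_lt_one_of_one_lt_of_neg one_lt_two (by linarith)
  have hD0 : 0 ≤ D := mul_nonneg hσ (add_nonneg (div_nonneg hQ (by linarith)) hQ)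
  have hpow : ∀ a : ℝ, 0 < a → Tendsto (fun n : ℕ => (n : ℝ) ^ (-a)) atTop (𝓝 0) := fun a ha =>
    (tendsto_rpow_neg_atTop ha).comp tendsto_natCast_atTop_atTop
  -- The variance is of the order `n ^ (β (1 + α) - 1)`, which vanishes since `2 r > 1`.
  have hexp : 0 < 1 - β * (1 + α) := by
    rw [hβ, sub_pos, one_div, inv_mul_lt_iff₀ hra]; linarith
  have hlim1 : Tendsto (fun n : ℕ => ENNReal.ofReal
      (D * c₁ ^ (-1 - α) / c / (η / 2) ^ 2 * (n : ℝ) ^ (-(1 - β * (1 + α)))) +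
      ENNReal.ofReal ((2 * κ ^ 2 * ‖g‖) ^ 2 / c / (η / 4) ^ 2 * (n : ℝ) ^ (-(1 : ℝ))))
      atTop (𝓝 0) := by
    have h1 := ENNReal.tendsto_ofReal ((hpow _ hexp).const_mul
      (D * c₁ ^ (-1 - α) / c / (η / 2) ^ 2))
    have h2 := ENNReal.tendsto_ofReal ((hpow 1 one_pos).const_mul
      ((2 * κ ^ 2 * ‖g‖) ^ 2 / c / (η / 4) ^ 2))
    simpa using h1.add h2
  have hlim2 : Tendsto (fun n : ℕ => c₂ * (n : ℝ) ^ (-β) * ‖g‖) atTop (𝓝 0) := by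
    simpa using ((hpow β hβ0).const_mul c₂).mul_const ‖g‖
  filter_upwards [hlim1.eventually_le_const hε,
    hlim2.eventually_le_const (by positivity : 0 < η / 8), eventually_ge_atTop 1] with n h1 h2 hn
  intro s hs t ht1 ht2
  rw [hβ'] at ht1 ht2
  have hn0 : (0 : ℝ) < n := by exact_mod_cast hn
  have hcn : 0 < c * n := by positivity
  have hcard : (0 : ℝ) < s.card := hcn.trans_le hs
  have hsne : s.Nonempty := Finset.card_pos.1 (by exact_mod_cast hcard)
  have hlow : 0 < c₁ * (n : ℝ) ^ (-β) := by positivity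
  have ht : 0 < t := hlow.trans_le ht1
  have htg : t * ‖g‖ ≤ η / 8 := (mul_le_mul_of_nonneg_right ht2 (norm_nonneg _)).trans h2
  refine (measure_krr_error_le hK hσ he hα hQ hdim hsne ht hη hg.le htg).trans (le_trans ?_ h1)
  have htpow : t ^ (-1 - α) ≤ c₁ ^ (-1 - α) * (n : ℝ) ^ (β * (1 + α)) := by
    calc t ^ (-1 - α) ≤ (c₁ * (n : ℝ) ^ (-β)) ^ (-1 - α) :=
          Real.rpow_le_rpow_of_nonpos hlow ht1 (by linarith)
      _ = c₁ ^ (-1 - α) * (n : ℝ) ^ (β * (1 + α)) := by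
          rw [Real.mul_rpow hc₁.le (by positivity), ← Real.rpow_mul hn0.le]
          congr 2; ring
  refine add_le_add (ENNReal.ofReal_le_ofReal ?_) (ENNReal.ofReal_le_ofReal ?_)
  · calc D * t ^ (-1 - α) / s.card / (η / 2) ^ 2
        ≤ D * (c₁ ^ (-1 - α) * (n : ℝ) ^ (β * (1 + α))) / (c * n) / (η / 2) ^ 2 := by
          gcongr
      _ = _ := by
          rw [neg_sub, Real.rpow_sub_one hn0.ne']
          field_simp
  · calc (2 * κ ^ 2 * ‖g‖) ^ 2 / s.card / (η / 4) ^ 2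
        ≤ (2 * κ ^ 2 * ‖g‖) ^ 2 / (c * n) / (η / 4) ^ 2 := by gcongr
      _ = _ := by
          rw [Real.rpow_neg_one]
          field_simp

end Consistency

/-! ### Ranks -/

section Rank

variable {m : ℕ}

theorem rank_congr {v w : Fin m → ℝ} (h : ∀ i j, v i ≤ v j ↔ w i ≤ w j) (k : Fin m) :
    rank v k = rank w k := by
  classical
  unfold rank
  congr 1
  exact Finset.filter_congr fun j _ => h j k

theorem rank_lt_rank {v : Fin m → ℝ} {i j : Fin m} (h : v i < v j) : rank v i < rank v j := by
  classical
  unfold rank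
  refine Finset.card_lt_card (Finset.ssubset_iff_subset_ne.2 ⟨fun l hl => ?_, fun heq => ?_⟩)
  · simp only [Finset.mem_filter, Finset.mem_univ, true_and] at hl ⊢
    exact hl.trans h.le
  · have : j ∈ Finset.univ.filter fun l => v l ≤ v i := by rw [heq]; simp
    simp only [Finset.mem_filter, Finset.mem_univ, true_and] at this
    exact absurd this (not_le.2 h)

theorem rank_le_rank_iff {v : Fin m → ℝ} {i j : Fin m} : rank v i ≤ rank v j ↔ v i ≤ v j := by
  refine ⟨fun h => not_lt.1 fun hlt => absurd h (not_le.2 (rank_lt_rank hlt)), fun h => ?_⟩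
  classical
  unfold rank
  refine Finset.card_le_card fun l hl => ?_
  simp only [Finset.mem_filter, Finset.mem_univ, true_and] at hl ⊢
  exact hl.trans h

theorem rank_mem_Icc (v : Fin m → ℝ) (k : Fin m) : rank v k ∈ Finset.Icc 1 m := by
  classical
  unfold rank
  rw [Finset.mem_Icc]
  refine ⟨Finset.card_pos.2 ⟨k, by simp⟩, ?_⟩
  simpa using Finset.card_filter_le (Finset.univ : Finset (Fin m)) fun j => v j ≤ v k

/-- Without ties, every rank is attained. -/
theorem exists_rank_eq {v : Fin m → ℝ} (hv : Function.Injective v) {ℓ : ℕ} (h1 : 1 ≤ ℓ)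
    (h2 : ℓ ≤ m) : ∃ k, rank v k = ℓ := by
  classical
  have hinj : Function.Injective (rank v) := fun i j hij =>
    hv (le_antisymm (rank_le_rank_iff.1 hij.le) (rank_le_rank_iff.1 hij.ge))
  have himage : Finset.univ.image (rank v) = Finset.Icc 1 m := by
    refine Finset.eq_of_subset_of_card_le (fun l hl => ?_) ?_
    · obtain ⟨k, -, rfl⟩ := Finset.mem_image.1 hl
      exact rank_mem_Icc v k
    · rw [Finset.card_image_of_injective _ hinj]; simp
  have : ℓ ∈ Finset.univ.image (rank v) := by rw [himage, Finset.mem_Icc]; exact ⟨h1, h2⟩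
  obtain ⟨k, -, hk⟩ := Finset.mem_image.1 this
  exact ⟨k, hk⟩

variable {H : Type*} [NormedAddCommGroup H] {f : Fin (m + 1) → H}

theorem mem_transferable {h : ℝ} {k : Fin m} : k ∈ transferable f h ↔ ‖contrast f k‖ ≤ h := by
  simp [transferable]

theorem card_transferable_norm (k : Fin m) :
    (transferable f ‖contrast f k‖).card = rank (fun j => ‖contrast f j‖) k := rfl

/-- `h_ℓ` is attained with exactly `ℓ` indices, and these are the ones of rank at most `ℓ`. -/
theorem isLeast_level (hpos : ∀ k, 0 < ‖contrast f k‖)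
    (hinj : Function.Injective fun k => ‖contrast f k‖) {ℓ : ℕ} (hℓ : ℓ ≤ m) :
    IsLeast {h : ℝ | 0 ≤ h ∧ (transferable f h).card = ℓ} (level f ℓ) ∧
      ∀ k, k ∈ transferable f (level f ℓ) ↔ rank (fun j => ‖contrast f j‖) k ≤ ℓ := by
  rcases Nat.eq_zero_or_pos ℓ with rfl | h1
  · have hlevel : level f 0 = 0 := by
      have : IsLeast {h : ℝ | 0 ≤ h ∧ 0 ≤ (transferable f h).card} 0 :=
        ⟨⟨le_rfl, Nat.zero_le _⟩, fun h hh => hh.1⟩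
      exact this.csInf_eq
    have hempty : transferable f 0 = ∅ := by
      ext k
      simp only [mem_transferable, Finset.notMem_empty, iff_false, not_le]
      exact hpos k
    rw [hlevel]
    refine ⟨⟨⟨le_rfl, by rw [hempty]; rfl⟩, fun h hh => hh.1⟩, fun k => ?_⟩
    have hk := (Finset.mem_Icc.1 (rank_mem_Icc (fun j => ‖contrast f j‖) k)).1
    rw [hempty]
    simp only [Finset.notMem_empty, false_iff, not_le]
    exact hk
  · obtain ⟨k, hk⟩ := exists_rank_eq hinj h1 hℓ
    have hleast : IsLeast {h : ℝ | 0 ≤ h ∧ ℓ ≤ (transferable f h).card} ‖contrast f k‖ := by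
      refine ⟨⟨norm_nonneg _, by rw [card_transferable_norm, hk]⟩, fun h hh => ?_⟩
      by_contra hlt
      rw [not_le] at hlt
      have hss : transferable f h ⊂ transferable f ‖contrast f k‖ := by
        refine Finset.ssubset_iff_subset_ne.2 ⟨fun l hl => ?_, fun heq => ?_⟩
        · rw [mem_transferable] at hl ⊢
          exact hl.trans hlt.le
        · have : k ∈ transferable f h := by rw [heq, mem_transferable]
          exact absurd (mem_transferable.1 this) (not_le.2 hlt)
      have := Finset.card_lt_card hss
      rw [card_transferable_norm, hk] at this
      exact absurd hh.2 (not_le.2 this)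
    have hlevel : level f ℓ = ‖contrast f k‖ := hleast.csInf_eq
    rw [hlevel]
    refine ⟨⟨⟨norm_nonneg _, by rw [card_transferable_norm, hk]⟩,
      fun h hh => hleast.2 ⟨hh.1, hh.2.ge⟩⟩, fun j => ?_⟩
    rw [mem_transferable, ← hk]
    exact (rank_le_rank_iff (v := fun j => ‖contrast f j‖)).symm

/-- Distinct numbers keep their order under perturbations smaller than half of the least gap. -/
theorem exists_pos_forall_le_iff {w : Fin m → ℝ} (hw : Function.Injective w) :
    ∃ η > 0, ∀ v : Fin m → ℝ, (∀ k, |v k - w k| < η) → ∀ i j, v i ≤ v j ↔ w i ≤ w j := by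
  obtain ⟨η, hη, hgap⟩ : ∃ η > 0, ∀ i j, w i < w j → η ≤ w j - w i := by
    classical
    let S : Finset (Fin m × Fin m) := Finset.univ.filter fun p => w p.1 < w p.2
    rcases S.eq_empty_or_nonempty with hS | hS
    · refine ⟨1, one_pos, fun i j hij => ?_⟩
      have : (i, j) ∈ S := by simp [S, hij]
      simp [hS] at this
    · obtain ⟨p, hp, hmin⟩ := S.exists_min_image (fun p => w p.2 - w p.1) hS
      refine ⟨w p.2 - w p.1, sub_pos.2 (Finset.mem_filter.1 hp).2, fun i j hij => ?_⟩
      exact hmin (i, j) (by simp [S, hij])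
  refine ⟨η / 2, half_pos hη, fun v hv => ?_⟩
  have hlt : ∀ i j, w i < w j → v i < v j := fun i j hij => by
    have h1 := hgap i j hij
    have h2 := abs_lt.1 (hv i)
    have h3 := abs_lt.1 (hv j)
    linarith [h2.2, h3.1]
  intro i j
  refine ⟨fun h => not_lt.1 fun h' => absurd h (not_le.2 (hlt j i h')), fun h => ?_⟩
  rcases h.eq_or_lt with h' | h'
  · rw [hw h']
  · exact (hlt i j h').le

end Rank

/-! ### Random subsamples and selection -/

section Sampling

variable {Ω α : Type*} [MeasurableSpace Ω] [MeasurableSpace α] {P : Measure Ω}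
  [IsProbabilityMeasure P] {μ : Measure α} {n : ℕ} {Z : Fin n → Ω → α}

theorem hasLaw_pi_of_iid (hlaw : ∀ i, HasLaw (Z i) μ P) (hindep : iIndepFun Z P) :
    HasLaw (fun ω i => Z i ω) (Measure.pi fun _ => μ) P := by
  refine ⟨aemeasurable_pi_iff.2 fun i => (hlaw i).aemeasurable, ?_⟩
  rw [(iIndepFun_iff_map_fun_eq_pi_map fun i => (hlaw i).aemeasurable).1 hindep]
  congr 1
  funext i
  exact (hlaw i).map_eq

omit [IsProbabilityMeasure P] in
theorem measure_setOf_mem_le_of_hasLaw {Y : Ω → α} (hY : HasLaw Y μ P) (S : Set α) :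
    P {ω | Y ω ∈ S} ≤ μ S := by
  calc P {ω | Y ω ∈ S} ≤ P (Y ⁻¹' toMeasurable μ S) :=
        measure_mono fun ω hω => subset_toMeasurable μ S hω
    _ = μ (toMeasurable μ S) := by
        rw [← Measure.map_apply_of_aemeasurable hY.aemeasurable (measurableSet_toMeasurable μ S),
          hY.map_eq]
    _ = μ S := measure_toMeasurable S

/-- A bound on the probability of an event that is uniform in a parameter extends to a random
parameter independent of the data. The events need not be measurable. -/
theorem measure_random_index_le {ι : Type*} [Fintype ι] [MeasurableSpace ι]
    [MeasurableSingletonClass ι] {Y : Ω → α} (hY : HasLaw Y μ P) {J : Ω → ι} (hJ : Measurable J)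
    (hind : IndepFun J Y P) {p : ι → Prop} {S : ι → Set α} {ε : ℝ≥0∞}
    (hS : ∀ s, p s → μ (S s) ≤ ε) :
    P {ω | p (J ω) ∧ Y ω ∈ S (J ω)} ≤ ε := by
  classical
  have hsub : {ω | p (J ω) ∧ Y ω ∈ S (J ω)} ⊆
      ⋃ s ∈ Finset.univ.filter p, J ⁻¹' {s} ∩ Y ⁻¹' toMeasurable μ (S s) := by
    rintro ω ⟨h1, h2⟩
    simp only [Finset.mem_filter, Finset.mem_univ, true_and, Set.mem_iUnion]
    exact ⟨J ω, h1, rfl, subset_toMeasurable μ _ h2⟩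
  calc P {ω | p (J ω) ∧ Y ω ∈ S (J ω)}
      ≤ ∑ s ∈ Finset.univ.filter p, P (J ⁻¹' {s} ∩ Y ⁻¹' toMeasurable μ (S s)) :=
        (measure_mono hsub).trans (measure_biUnion_finset_le _ _)
    _ ≤ ∑ s ∈ Finset.univ.filter p, P (J ⁻¹' {s}) * ε := by
        refine Finset.sum_le_sum fun s hs => ?_
        rw [hind.measure_inter_preimage_eq_mul _ _ (measurableSet_singleton s)
          (measurableSet_toMeasurable _ _)]
        gcongr
        rw [← Measure.map_apply_of_aemeasurable hY.aemeasurable (measurableSet_toMeasurable _ _),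
          hY.map_eq, measure_toMeasurable]
        exact hS s (Finset.mem_filter.1 hs).2
    _ ≤ 1 * ε := by
        rw [← Finset.sum_mul]
        gcongr
        rw [sum_measure_preimage_singleton _ fun s _ => hJ (measurableSet_singleton s)]
        exact prob_le_one
    _ = ε := one_mul ε

end Sampling

section Selection

variable {X : Type*} {H : Type*} [NormedAddCommGroup H] [InnerProductSpace ℝ H]
  [CompleteSpace H] [RKHS ℝ H X ℝ] {m : ℕ}

omit [CompleteSpace H] in
/-- The selected sets agree as soon as all estimators are accurate. -/
theorem exists_pos_estTransferable_eq {f : Fin (m + 1) → H} (hpos : ∀ k, 0 < ‖contrast f k‖)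
    (hinj : Function.Injective fun k => ‖contrast f k‖) :
    ∃ η > 0, ∀ {n : Fin (m + 1) → ℕ} (z : ∀ k, Fin (n k) → X × ℝ) (J : Finset (Fin (n 0)))
      (lam : Fin (m + 1) → ℝ), ‖krr H J (z 0) (lam 0) - f 0‖ < η →
      (∀ k : Fin m, ‖krr H Finset.univ (z k.succ) (lam k.succ) - f k.succ‖ < η) →
      ∀ ℓ ≤ m, estTransferable H z J lam ℓ = transferable f (level f ℓ) := by
  obtain ⟨η, hη, hstable⟩ := exists_pos_forall_le_iff hinj
  refine ⟨η / 2, half_pos hη, fun z J lam h0 hk ℓ hℓ => ?_⟩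
  have hdiff : ∀ k, |‖estContrast H z J lam k‖ - ‖contrast f k‖| < η := by
    intro k
    have h1 : estContrast H z J lam k + contrast f k =
        (krr H Finset.univ (z k.succ) (lam k.succ) - f k.succ) -
          (krr H J (z 0) (lam 0) - f 0) := by
      unfold estContrast contrast; abel
    rw [← norm_neg (contrast f k)]
    refine (abs_norm_sub_norm_le _ _).trans_lt ?_
    rw [sub_neg_eq_add, h1]
    refine (norm_sub_le _ _).trans_lt ?_
    linarith [hk k]
  ext k
  rw [(isLeast_level hpos hinj hℓ).2, ← rank_congr (hstable _ hdiff)]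
  simp [estTransferable]

end Selection

end TransferKRR

end

theorem corollary1
    -- the compact domain, the RKHS with its kernel, and the common marginal distribution
    {d : ℕ} (X : Set (EuclideanSpace ℝ (Fin d))) (_hX : IsCompact X)
    {H : Type*} [NormedAddCommGroup H] [InnerProductSpace ℝ H] [CompleteSpace H] [RKHS ℝ H X ℝ]
    (ρx : Measure X) [IsProbabilityMeasure ρx]
    (κ : ℝ) (hK : TransferKRR.BoundedKernel H ρx κ)
    -- the target (index 0) and the sources: conditional distributions and regression functions
    (m : ℕ) (ρy : Fin (m + 1) → Kernel X ℝ) [∀ k, IsMarkovKernel (ρy k)]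
    (f : Fin (m + 1) → H) (hf : ∀ k, ∀ᵐ x ∂ρx, f k x = ∫ y, y ∂(ρy k x))
    -- moment condition on the noise
    (hsq : ∀ k, Integrable (fun z : X × ℝ => z.2 ^ 2) (ρx ⊗ₘ ρy k))
    (B γ : ℝ) (hB : 0 < B) (hγ : 0 < γ)
    (hnoise : ∀ k, ∀ᵐ x ∂ρx,
      ∫⁻ y, ENNReal.ofReal (Real.exp (|y - f k x| / B) - |y - f k x| / B - 1) ∂(ρy k x)
        ≤ ENNReal.ofReal (γ ^ 2 / (2 * B ^ 2)))
    -- effective dimension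
    (α Q : ℝ) (hα : 0 < α) (hα1 : α ≤ 1) (hQ : 1 ≤ Q)
    (hdim : ∀ t : ℝ, 0 < t → TransferKRR.effectiveDim hK t ≤ ENNReal.ofReal (Q * t ^ (-α)))
    -- regularity of the regression functions
    (r : ℝ) (hr : 1 / 2 < r) (hr1 : r ≤ 1)
    (hreg : ∀ k, ∃ g : Lp ℝ 2 ρx, f k = TransferKRR.integralOpPow hK r g)
    -- for all sample sizes `n`: the data sets, each i.i.d., and the random first part of the
    -- target data
    {Ω : (Fin (m + 1) → ℕ) → Type*} [∀ n, MeasurableSpace (Ω n)]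
    (P : ∀ n, Measure (Ω n)) [∀ n, IsProbabilityMeasure (P n)]
    (Z : ∀ n : Fin (m + 1) → ℕ, ∀ k, Fin (n k) → Ω n → X × ℝ)
    (hlaw : ∀ n k i, HasLaw (Z n k i) (ρx ⊗ₘ ρy k) (P n))
    (hindep : ∀ n k, iIndepFun (Z n k) (P n))
    (J : ∀ n : Fin (m + 1) → ℕ, Ω n → Finset (Fin (n 0)))
    (hJmeas : ∀ n, Measurable (J n))
    (hJindep : ∀ n, IndepFun (J n) (fun ω i => Z n 0 i ω) (P n))
    (c : ℝ) (hc : 0 < c)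
    (hJcard : Tendsto (fun n => P n {ω | c * (n 0 : ℝ) ≤ ((J n ω).card : ℝ)}) atTop (𝓝 1))
    -- the regularization parameters, of the order `n_k ^ (-1 / (2 r + α))`
    (lam : (Fin (m + 1) → ℕ) → Fin (m + 1) → ℝ) (c₁ c₂ : ℝ) (hc₁ : 0 < c₁) (hc₂ : 0 < c₂)
    (hlam : ∀ n : Fin (m + 1) → ℕ, (∀ k, 1 ≤ n k) → ∀ k,
      c₁ * (n k : ℝ) ^ (-1 / (2 * r + α)) ≤ lam n k ∧
        lam n k ≤ c₂ * (n k : ℝ) ^ (-1 / (2 * r + α)))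
    -- the norms of the contrasts are positive and pairwise distinct
    (hpos : ∀ k, 0 < ‖TransferKRR.contrast f k‖)
    (hdist : ∀ i j, i ≠ j → ‖TransferKRR.contrast f i‖ ≠ ‖TransferKRR.contrast f j‖) :
    ∀ ℓ : ℕ, ℓ ≤ m →
      IsLeast {h : ℝ | 0 ≤ h ∧ (TransferKRR.transferable f h).card = ℓ} (TransferKRR.level f ℓ) ∧
      Tendsto (fun n => P n {ω |
          TransferKRR.estTransferable H (fun k i => Z n k i ω) (J n ω) (lam n) ℓ =
            TransferKRR.transferable f (TransferKRR.level f ℓ)})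
        atTop (𝓝 1) := by
  intro ℓ hℓ
  have hinj : Function.Injective fun k => ‖TransferKRR.contrast f k‖ := fun i j hij =>
    by_contra fun hne => hdist i j hne hij
  refine ⟨(TransferKRR.isLeast_level hpos hinj hℓ).1, ?_⟩
  obtain ⟨η, hη, hsel⟩ := TransferKRR.exists_pos_estTransferable_eq (X := X) hpos hinj
  set E : ∀ n, Set (Ω n) := fun n => {ω |
    TransferKRR.estTransferable H (fun k i => Z n k i ω) (J n ω) (lam n) ℓ =
      TransferKRR.transferable f (TransferKRR.level f ℓ)}
  have htail : ∀ k (c' : ℝ), 0 < c' → ∀ ε : ℝ≥0∞, 0 < ε → ∀ᶠ n : Fin (m + 1) → ℕ in atTop,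
      ∀ s : Finset (Fin (n k)), c' * (n k : ℝ) ≤ s.card →
        (Measure.pi fun _ => ρx ⊗ₘ ρy k) {z : Fin (n k) → X × ℝ |
          η ≤ ‖TransferKRR.krr H s z (lam n k) - f k‖} ≤ ε := by
    intro k c' hc' ε hε
    obtain ⟨g, hg⟩ := hreg k
    have hcons := TransferKRR.krr_consistent hK (sq_nonneg γ)
      (TransferKRR.centeredResidual hK (hf k) (hsq k) hB (hnoise k)) hα (by linarith) hdim
      (hg ▸ TransferKRR.integralOpPow_mem_closure_range hK r g) hr hc' hc₁ (c₂ := c₂) hη hε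
    have htend : Tendsto (fun n : Fin (m + 1) → ℕ => n k) atTop atTop :=
      tendsto_atTop.2 fun b => eventually_atTop.2 ⟨fun _ => b, fun n hn => hn k⟩
    filter_upwards [htend.eventually hcons, eventually_ge_atTop fun _ => 1] with n h1 h2 s hs
    obtain ⟨h3, h4⟩ := hlam n (fun k => h2 k) k
    exact h1 s hs _ h3 h4
  have hcompl : Tendsto (fun n => P n (E n)ᶜ) atTop (𝓝 0) := by
    rw [ENNReal.tendsto_nhds_zero]
    intro ε hε
    have hm0 : ((m : ℝ≥0∞) + 2) ≠ 0 := by simp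
    have hmtop : ((m : ℝ≥0∞) + 2) ≠ ⊤ := by finiteness
    set ε' := ε / (m + 2) with hε'
    have hε'0 : 0 < ε' := ENNReal.div_pos hε.ne' hmtop
    have hsmall : ∀ᶠ n in atTop, P n {ω | c * (n 0 : ℝ) ≤ ((J n ω).card : ℝ)}ᶜ ≤ ε' := by
      have h1 : Tendsto (fun n => 1 - P n {ω | c * (n 0 : ℝ) ≤ ((J n ω).card : ℝ)}) atTop
          (𝓝 (1 - 1)) := ENNReal.Tendsto.sub tendsto_const_nhds hJcard (by simp)
      rw [tsub_self] at h1
      filter_upwards [h1.eventually_le_const hε'0] with n hn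
      have hmeas : MeasurableSet {ω | c * (n 0 : ℝ) ≤ ((J n ω).card : ℝ)} := hJmeas n (Set.toFinite
        {s : Finset (Fin (n 0)) | c * (n 0 : ℝ) ≤ (s.card : ℝ)}).measurableSet
      rwa [prob_compl_eq_one_sub hmeas]
    filter_upwards [hsmall, htail 0 c hc ε' hε'0,
      eventually_all.2 fun k : Fin m => htail k.succ 1 one_pos ε' hε'0] with n h1 h2 h3
    have hsub : (E n)ᶜ ⊆ ({ω | c * (n 0 : ℝ) ≤ ((J n ω).card : ℝ)}ᶜ ∪
        {ω | c * (n 0 : ℝ) ≤ ((J n ω).card : ℝ) ∧ (fun i => Z n 0 i ω) ∈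
          {z | η ≤ ‖TransferKRR.krr H (J n ω) z (lam n 0) - f 0‖}}) ∪
        ⋃ k : Fin m, {ω | (fun i => Z n k.succ i ω) ∈
          {z | η ≤ ‖TransferKRR.krr H Finset.univ z (lam n k.succ) - f k.succ‖}} := by
      intro ω hω
      by_contra hcon
      simp only [Set.mem_union, Set.mem_compl_iff, Set.mem_ofPred_eq, Set.mem_iUnion, not_or,
        not_and, not_exists, not_le, not_lt] at hcon
      exact hω (hsel (fun k i => Z n k i ω) (J n ω) (lam n) (hcon.1.2 hcon.1.1) hcon.2 ℓ hℓ)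
    have h4 := TransferKRR.measure_random_index_le
      (TransferKRR.hasLaw_pi_of_iid (hlaw n 0) (hindep n 0)) (hJmeas n) (hJindep n)
      (p := fun s => c * (n 0 : ℝ) ≤ (s.card : ℝ))
      (S := fun s => {z | η ≤ ‖TransferKRR.krr H s z (lam n 0) - f 0‖}) h2
    have h5 : ∀ k : Fin m, P n {ω | (fun i => Z n k.succ i ω) ∈
        {z | η ≤ ‖TransferKRR.krr H Finset.univ z (lam n k.succ) - f k.succ‖}} ≤ ε' := fun k =>
      (TransferKRR.measure_setOf_mem_le_of_hasLaw
        (TransferKRR.hasLaw_pi_of_iid (hlaw n k.succ) (hindep n k.succ)) _).trans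
        (h3 k _ (by simp))
    calc P n (E n)ᶜ ≤ (ε' + ε') + ∑ _k : Fin m, ε' :=
          (measure_mono hsub).trans ((measure_union_le _ _).trans (add_le_add
            ((measure_union_le _ _).trans (add_le_add h1 h4))
            ((measure_iUnion_fintype_le _ _).trans (Finset.sum_le_sum fun k _ => h5 k))))
      _ = (m + 2) * ε' := by
          rw [Finset.sum_const, Finset.card_univ, Fintype.card_fin, nsmul_eq_mul]; ring
      _ = ε := ENNReal.mul_div_cancel hm0 hmtop
  have hlow : Tendsto (fun n => 1 - P n (E n)ᶜ) atTop (𝓝 1) := by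
    simpa using ENNReal.Tendsto.sub (tendsto_const_nhds (x := (1 : ℝ≥0∞))) hcompl (by simp)
  refine tendsto_of_tendsto_of_tendsto_of_le_of_le hlow tendsto_const_nhds (fun n => ?_)
    fun n => prob_le_one
  -- The event need not be measurable, so that only subadditivity is available.
  rw [tsub_le_iff_right]
  calc (1 : ℝ≥0∞) = P n (E n ∪ (E n)ᶜ) := by rw [Set.union_compl_self, measure_univ]
    _ ≤ P n (E n) + P n (E n)ᶜ := measure_union_le _ _
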